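/- Let $X$ and $Y$ be random vectors on a common probability space, valued in $\mathbb R^m$ and $\mathbb R^n$, whose joint law $P_{XY}$ is multivariate normal and such that $P_{XY}$ and its marginals $P_X$, $P_Y$ have smooth, everywhere positive densities $p_{XY}$, $p_X$, $p_Y$ with respect to Lebesgue measure. Let $\mathrm{PMI}_{XY}(x,y)=\log\frac{p_{XY}(x,y)}{p_X(x)\,p_Y(y)}$ be the pointwise mutual information, let the PMI profile $\mathrm{Prof}_{XY}$ be the law of the random variable $\mathrm{PMI}_{XY}(X,Y)$, and let $\mathbf I(X;Y)=D_{\mathrm{KL}}(P_{XY}\,\|\,P_X\otimes P_Y)$ be the mutual information (in nats). Let $k=\min(m,n)$ and let $\rho_1\ge\dots\ge\rho_k\ge 0$ be the canonical correlations between $X$ and $Y$, i.e. the $k$ largest singular values, counted with multiplicity, of $\Sigma_X^{-1/2}\Sigma_{XY}\Sigma_Y^{-1/2}$, where $\Sigma_X,\Sigma_Y$ are the covariance matrices of $X$, $Y$ and $\Sigma_{XY}$ is their cross-covariance matrix. Then: 1. $\mathrm{Prof}_{XY}$ is a generalized $\chi^2$ distribution, namely the distribution of $$T=\mathbf I(X;Y)+\sum_{i=1}^k\frac{\rho_i}{2}\,(Q_i-Q_i'),$$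 where $Q_1,\dots,Q_k,Q_1',\dots,Q_k'$ are i.i.d. random variables with the $\chi^2_1$ distribution. 2. $\mathrm{Prof}_{XY}$ is symmetric around its (unique) median, which coincides with its mean, and the mean equals the mutual information, which is finite and given by $$\mathbf I(X;Y)=-\frac12\sum_{i=1}^k\log\left(1-\rho_i^2\right),$$ where $\rho_i^2<1$ for every $i$. 3. All the moments of $\mathrm{Prof}_{XY}$ exist, and its variance equals $\rho_1^2+\dots+\rho_k^2$. -/

import Mathlib

open MeasureTheory ProbabilityTheory
open scoped ENNReal

noncomputable section

namespace PMI

/-- `p` is a smooth, everywhere positive probability density function of `μ` with respect to the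
reference measure (`volume`). -/
structure IsSmoothPosDensity {E : Type*} [NormedAddCommGroup E] [NormedSpace ℝ E] [MeasureSpace E]
    (μ : Measure E) (p : E → ℝ) : Prop where
  contDiff : ContDiff ℝ ((⊤ : ℕ∞) : WithTop ℕ∞) p
  pos : ∀ x, 0 < p x
  eq_withDensity : μ = volume.withDensity (fun x => ENNReal.ofReal (p x))

/-- A measure has at most one smooth positive density. -/
theorem IsSmoothPosDensity.unique {E : Type*} [NormedAddCommGroup E] [NormedSpace ℝ E]
    [MeasureSpace E] [OpensMeasurableSpace E] [SigmaFinite (volume : Measure E)]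
    [(volume : Measure E).IsOpenPosMeasure] {μ : Measure E} {p q : E → ℝ}
    (hp : IsSmoothPosDensity μ p) (hq : IsSmoothPosDensity μ q) : p = q := by
  have h := hp.eq_withDensity.symm.trans hq.eq_withDensity
  have h := (withDensity_eq_iff_of_sigmaFinite
    hp.contDiff.continuous.measurable.ennreal_ofReal.aemeasurable
    hq.contDiff.continuous.measurable.ennreal_ofReal.aemeasurable).1 h
  refine (hp.contDiff.continuous.ae_eq_iff_eq volume hq.contDiff.continuous).1 ?_
  filter_upwards [h] with x hx
  exact (ENNReal.ofReal_eq_ofReal_iff (hp.pos x).le (hq.pos x).le).1 hx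

open Classical in
/-- The smooth positive density of `μ` (and `0` if there is none). -/
def smoothDensity {E : Type*} [NormedAddCommGroup E] [NormedSpace ℝ E] [MeasureSpace E]
    (μ : Measure E) : E → ℝ :=
  if h : ∃ p : E → ℝ, IsSmoothPosDensity μ p then h.choose else 0

theorem IsSmoothPosDensity.smoothDensity_eq {E : Type*} [NormedAddCommGroup E] [NormedSpace ℝ E]
    [MeasureSpace E] [OpensMeasurableSpace E] [SigmaFinite (volume : Measure E)]
    [(volume : Measure E).IsOpenPosMeasure] {μ : Measure E} {p : E → ℝ}
    (hp : IsSmoothPosDensity μ p) : smoothDensity μ = p := by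
  have h : ∃ p : E → ℝ, IsSmoothPosDensity μ p := ⟨p, hp⟩
  rw [smoothDensity, dif_pos h]
  exact h.choose_spec.unique hp

/-- The joint law of `(X, Y)` and both marginal laws have smooth and positive densities. -/
structure HasSmoothPosDensities {Ω E F : Type*} [MeasurableSpace Ω]
    [NormedAddCommGroup E] [NormedSpace ℝ E] [MeasureSpace E]
    [NormedAddCommGroup F] [NormedSpace ℝ F] [MeasureSpace F]
    (X : Ω → E) (Y : Ω → F) (P : Measure Ω) : Prop where
  joint : ∃ p : E × F → ℝ, IsSmoothPosDensity (P.map (fun ω => (X ω, Y ω))) p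
  fst : ∃ p : E → ℝ, IsSmoothPosDensity (P.map X) p
  snd : ∃ p : F → ℝ, IsSmoothPosDensity (P.map Y) p

/-- The pointwise mutual information function `log (p_XY(x, y) / (p_X(x) p_Y(y)))`. -/
def pmi {Ω E F : Type*} [MeasurableSpace Ω]
    [NormedAddCommGroup E] [NormedSpace ℝ E] [MeasureSpace E]
    [NormedAddCommGroup F] [NormedSpace ℝ F] [MeasureSpace F]
    (X : Ω → E) (Y : Ω → F) (P : Measure Ω) (z : E × F) : ℝ :=
  Real.log (smoothDensity (P.map (fun ω => (X ω, Y ω))) z /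
    (smoothDensity (P.map X) z.1 * smoothDensity (P.map Y) z.2))

/-- The PMI profile: the law of the random variable `PMI_XY(X, Y)`. -/
def pmiProfile {Ω E F : Type*} [MeasurableSpace Ω]
    [NormedAddCommGroup E] [NormedSpace ℝ E] [MeasureSpace E]
    [NormedAddCommGroup F] [NormedSpace ℝ F] [MeasureSpace F]
    (X : Ω → E) (Y : Ω → F) (P : Measure Ω) : Measure ℝ :=
  P.map (fun ω => pmi X Y P (X ω, Y ω))

/-- Mutual information in nats: the Kullback-Leibler divergence of the joint law from the product
of the marginal laws. -/
def mutualInfo {Ω E F : Type*} [MeasurableSpace Ω] [MeasurableSpace E] [MeasurableSpace F]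
    (X : Ω → E) (Y : Ω → F) (P : Measure Ω) : ℝ≥0∞ :=
  InformationTheory.klDiv (P.map (fun ω => (X ω, Y ω))) ((P.map X).prod (P.map Y))

/-- The cross-covariance matrix, with entries `cov(X_i, Y_j)`; `crossCov X X P` is the covariance
matrix of `X`. -/
def crossCov {Ω : Type*} [MeasurableSpace Ω] {m n : ℕ}
    (X : Ω → EuclideanSpace ℝ (Fin m)) (Y : Ω → EuclideanSpace ℝ (Fin n)) (P : Measure Ω) :
    Matrix (Fin m) (Fin n) ℝ :=
  Matrix.of fun i j => covariance (fun ω => X ω i) (fun ω => Y ω j) P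

open scoped MatrixOrder in
/-- The whitened cross-covariance matrix `Σ_X^(-1/2) Σ_XY Σ_Y^(-1/2)`. -/
def whitenedCrossCov {Ω : Type*} [MeasurableSpace Ω] {m n : ℕ}
    (X : Ω → EuclideanSpace ℝ (Fin m)) (Y : Ω → EuclideanSpace ℝ (Fin n)) (P : Measure Ω) :
    Matrix (Fin m) (Fin n) ℝ :=
  (CFC.sqrt (crossCov X X P))⁻¹ * crossCov X Y P * (CFC.sqrt (crossCov Y Y P))⁻¹

/-- The canonical correlations of `X` and `Y`: the `min m n` largest singular values, in
decreasing order and with multiplicity, of the whitened cross-covariance matrix. -/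
def canonicalCorrelation {Ω : Type*} [MeasurableSpace Ω] {m n : ℕ}
    (X : Ω → EuclideanSpace ℝ (Fin m)) (Y : Ω → EuclideanSpace ℝ (Fin n)) (P : Measure Ω)
    (i : Fin (min m n)) : ℝ :=
  (Matrix.toEuclideanLin (whitenedCrossCov X Y P)).singularValues i

/-- The `χ²` distribution with one degree of freedom: the law of `Z²` for `Z ∼ N(0, 1)`. -/
def chiSquaredOne : Measure ℝ := (gaussianReal 0 1).map (fun z => z ^ 2)

/-- `c` is a median of `ν`. -/
def IsMedian (ν : Measure ℝ) (c : ℝ) : Prop :=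
  1 / 2 ≤ ν (Set.Iic c) ∧ 1 / 2 ≤ ν (Set.Ici c)

/-- `ν` is symmetric around `c`: it is invariant under the reflection `t ↦ 2c - t`. -/
def IsSymmetricAround (ν : Measure ℝ) (c : ℝ) : Prop :=
  ν.map (fun t => 2 * c - t) = ν

end PMI

end

noncomputable section

namespace PMI

/-! ### The law of `c + ∑ i, (ρ i / 2) (Q i - Q' i)`: symmetry, moments, median. -/

section

/-! The PMI is almost surely the logarithm of the density of the joint law with respect to the
product of the marginals (`pmi_ae_eq_log`), and this density is carried along by injective recodings
of each variable separately (`eq_withDensity_comp_of_map`). Whitening followed by a singular value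
decomposition (`exists_canonical_coordinates`, `exists_isCanonicalPair`) therefore reduces
everything to standard Gaussian vectors whose only correlations are `cov(x_j, y_j) = σ j`.

There the density is a product of bivariate factors (`map_prod`). The exponent of each factor is
diagonal in `x + y` and `x - y` (`log_correlationDensity`), and these sums and differences, once
normalized, are i.i.d. standard Gaussian (`iIndepFun_normalized`). Hence the logarithm of the
density is a constant plus a weighted sum of differences of independent `χ²₁` variables.

Exchanging each `Q i` with `Q' i` reflects this law about the constant, which is therefore its mean.
The mean of the log density is the Kullback-Leibler divergence (`mutualInfo_eq_integral_log`), so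
the constant is the mutual information. The median, the moments and the variance are then read off
`chiSquaredDiff`. -/

theorem integral_sq_gaussianReal : ∫ z, z ^ 2 ∂(gaussianReal 0 1) = 1 := by
  have h := variance_fun_id_gaussianReal (μ := 0) (v := 1)
  rw [variance_eq_integral measurable_id'.aemeasurable] at h
  simpa using h

theorem integral_pow_four_gaussianReal : ∫ z, z ^ 4 ∂(gaussianReal 0 1) = 3 := by
  have h := iteratedDeriv_mgf_zero (X := fun x : ℝ => x) (μ := gaussianReal 0 1) (by simp) 4
  have e : ∀ t : ℝ, HasDerivAt (fun t : ℝ => Real.exp (t ^ 2 / 2)) (t * Real.exp (t ^ 2 / 2)) t := by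
    intro t
    have := ((hasDerivAt_pow 2 t).div_const 2).exp
    convert this using 1
    ring
  -- Differentiating `p(t) exp(t²/2)` replaces the factor `p` by `p' + t p`. Four rounds starting
  -- from `p = 1` give the fourth derivative of the moment generating function. The factors below
  -- are left unsimplified so that each result matches the next one syntactically.
  have step : ∀ p p' : ℝ → ℝ, (∀ t, HasDerivAt p (p' t) t) →
      deriv (fun t : ℝ => p t * Real.exp (t ^ 2 / 2)) =
        fun t => (p' t + t * p t) * Real.exp (t ^ 2 / 2) := by
    intro p p' hp
    ext t
    refine ((hp t).mul (e t)).deriv.trans ?_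
    ring
  have h1 := step (fun _ => 1) (fun _ => 0) (fun t => hasDerivAt_const t 1)
  have h2 := step (fun t => 0 + t * 1) (fun _ => 0 + 1 * 1)
    (fun t => ((hasDerivAt_id t).mul_const 1).const_add 0 |>.congr_deriv (by simp))
  have h3 := step (fun t => 0 + 1 * 1 + t * (0 + t * 1)) (fun t => 2 * t)
    (fun t => by
      have := (hasDerivAt_pow 2 t).const_add 1
      refine (this.congr_deriv (by simp)).congr_of_eventuallyEq (.of_forall fun s => ?_)
      ring)
  have h4 := step (fun t => 2 * t + t * (0 + 1 * 1 + t * (0 + t * 1))) (fun t => 3 + 3 * t ^ 2)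
    (fun t => by
      have := ((hasDerivAt_id t).const_mul 3).add (hasDerivAt_pow 3 t)
      refine (this.congr_deriv (by simp)).congr_of_eventuallyEq (.of_forall fun s => ?_)
      simp only [Pi.add_apply, id]
      ring)
  have hm : mgf (fun x : ℝ => x) (gaussianReal 0 1) = fun t => 1 * Real.exp (t ^ 2 / 2) := by
    rw [mgf_fun_id_gaussianReal]
    ext t
    simp
  rw [hm, iteratedDeriv_succ', h1, iteratedDeriv_succ', h2, iteratedDeriv_succ', h3,
    iteratedDeriv_one, h4] at h
  simpa using h.symm

instance : IsProbabilityMeasure chiSquaredOne :=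
  Measure.isProbabilityMeasure_map (by fun_prop)

theorem memLp_sq_gaussianReal (r : ℕ) : MemLp (fun z : ℝ => z ^ 2) r (gaussianReal 0 1) := by
  have h : MemLp (fun z : ℝ => z) (2 * r : ℕ) (gaussianReal 0 1) :=
    memLp_id_gaussianReal' _ (ENNReal.natCast_ne_top _)
  by_cases hr : r = 0
  · subst hr
    simpa using (by fun_prop : AEStronglyMeasurable (fun z : ℝ => z ^ 2) (gaussianReal 0 1))
  have h' := h.integrable_norm_pow (by positivity)
  rw [← integrable_norm_rpow_iff (by fun_prop) (by simpa using hr) (ENNReal.natCast_ne_top _)]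
  simpa [pow_mul] using h'

theorem memLp_id_chiSquaredOne (r : ℕ) : MemLp (fun q : ℝ => q) r chiSquaredOne := by
  rw [chiSquaredOne, memLp_map_measure_iff (by fun_prop) (by fun_prop)]
  exact memLp_sq_gaussianReal r

theorem variance_id_chiSquaredOne : Var[fun q => q; chiSquaredOne] = 2 := by
  rw [chiSquaredOne, variance_map (by fun_prop) (by fun_prop)]
  simp only [Function.comp_def]
  rw [variance_eq_sub (memLp_sq_gaussianReal 2), integral_sq_gaussianReal]
  have : (fun z : ℝ => z ^ 2) ^ 2 = fun z : ℝ => z ^ 4 := by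
    ext z; simp; ring
  rw [this, integral_pow_four_gaussianReal]
  norm_num

theorem chiSquaredOne_ball_pos {δ : ℝ} (hδ : 0 < δ) : 0 < chiSquaredOne (Metric.ball 0 δ) := by
  have : (gaussianReal 0 1).IsOpenPosMeasure :=
    (gaussianReal_absolutelyContinuous' 0 one_ne_zero).isOpenPosMeasure
  rw [chiSquaredOne, Measure.map_apply (by fun_prop) measurableSet_ball]
  refine (Metric.isOpen_ball.preimage (by fun_prop)).measure_pos _ ⟨0, ?_⟩
  simpa using hδ

variable {ι : Type*} [Fintype ι]

/-- The law of `c + ∑ i, (ρ i / 2) (Q i - Q' i)` for i.i.d. `χ²₁` variables `Q i`, `Q' i`. -/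
def chiSquaredDiff (c : ℝ) (ρ : ι → ℝ) : Measure ℝ :=
  (Measure.pi fun _ : ι ⊕ ι => chiSquaredOne).map
    fun q => c + ∑ i, ρ i / 2 * (q (.inl i) - q (.inr i))

instance (c : ℝ) (ρ : ι → ℝ) : IsProbabilityMeasure (chiSquaredDiff c ρ) :=
  Measure.isProbabilityMeasure_map (by fun_prop)

theorem hasLaw_chiSquaredDiff {Ω : Type*} [MeasurableSpace Ω] {P : Measure Ω} (c : ℝ) (ρ : ι → ℝ)
    {Q Q' : ι → Ω → ℝ} (hQ : ∀ i, HasLaw (Q i) chiSquaredOne P)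
    (hQ' : ∀ i, HasLaw (Q' i) chiSquaredOne P) (hind : iIndepFun (Sum.elim Q Q') P) :
    HasLaw (fun ω => c + ∑ i, ρ i / 2 * (Q i ω - Q' i ω)) (chiSquaredDiff c ρ) P := by
  have h := hind.hasLaw_pi (μ := fun _ => chiSquaredOne) (by rintro (i | i) <;> simp [hQ, hQ'])
  have h' : HasLaw (fun q : ι ⊕ ι → ℝ => c + ∑ i, ρ i / 2 * (q (.inl i) - q (.inr i)))
      (chiSquaredDiff c ρ) (Measure.pi fun _ => chiSquaredOne) := ⟨by fun_prop, rfl⟩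
  exact h'.fun_comp h

/-- Exchanging the two families of i.i.d. variables preserves their joint law and changes the sign
of the sum. -/
theorem isSymmetricAround_chiSquaredDiff (c : ℝ) (ρ : ι → ℝ) :
    IsSymmetricAround (chiSquaredDiff c ρ) c := by
  let μ := Measure.pi fun _ : ι ⊕ ι => chiSquaredOne
  have hlaw : ∀ s : ι ⊕ ι, HasLaw (fun q : ι ⊕ ι → ℝ => q s) chiSquaredOne μ := fun s =>
    (measurePreserving_eval (fun _ : ι ⊕ ι => chiSquaredOne) s).hasLaw
  have hind : iIndepFun (fun (s : ι ⊕ ι) (q : ι ⊕ ι → ℝ) => q s) μ :=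
    iIndepFun_pi (X := fun _ => id) fun _ => aemeasurable_id
  have h := hasLaw_chiSquaredDiff c ρ (fun i => hlaw (.inr i)) (fun i => hlaw (.inl i)) (by
    convert hind.precomp (g := Sum.swap) Sum.swap_leftInverse.injective using 1
    ext (i | i) <;> rfl)
  -- The right-hand side becomes the law of the exchanged sum, while the left-hand side is put back
  -- in its original form. Both are then pushforwards of `μ`, under functions that agree pointwise.
  rw [IsSymmetricAround, ← h.map_eq]
  nth_rw 1 [h.map_eq]
  rw [chiSquaredDiff, Measure.map_map (by fun_prop) (by fun_prop)]
  congr 1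
  ext q
  simp only [Function.comp_def]
  rw [two_mul, add_sub_assoc, sub_add_cancel_left, ← Finset.sum_neg_distrib]
  congr 1
  exact Finset.sum_congr rfl fun i _ => by ring

theorem sum_diff_eq_sum (ρ : ι → ℝ) (q : ι ⊕ ι → ℝ) :
    ∑ i, ρ i / 2 * (q (.inl i) - q (.inr i)) =
      ∑ s, Sum.elim (fun i => ρ i / 2) (fun i => -(ρ i / 2)) s * q s := by
  rw [Fintype.sum_sum_type, ← Finset.sum_add_distrib]
  exact Finset.sum_congr rfl fun i _ => by simp; ring

theorem memLp_chiSquaredDiff (c : ℝ) (ρ : ι → ℝ) (r : ℕ) :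
    MemLp (fun t : ℝ => t) r (chiSquaredDiff c ρ) := by
  rw [chiSquaredDiff, memLp_map_measure_iff (by fun_prop) (by fun_prop)]
  refine (memLp_const c).add (memLp_finsetSum _ fun i _ => MemLp.const_mul ?_ _)
  exact ((memLp_id_chiSquaredOne r).comp_measurePreserving (measurePreserving_eval _ _)).sub
    ((memLp_id_chiSquaredOne r).comp_measurePreserving (measurePreserving_eval _ _))

theorem integrable_pow_chiSquaredDiff (c : ℝ) (ρ : ι → ℝ) (r : ℕ) :
    Integrable (fun t : ℝ => t ^ r) (chiSquaredDiff c ρ) :=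
  (memLp_chiSquaredDiff c ρ r).integrable_norm_pow'.mono (by fun_prop) (by simp)

theorem integral_chiSquaredDiff (c : ℝ) (ρ : ι → ℝ) : ∫ t, t ∂(chiSquaredDiff c ρ) = c := by
  have hi : Integrable (fun t : ℝ => t) (chiSquaredDiff c ρ) := by
    simpa using integrable_pow_chiSquaredDiff c ρ 1
  -- By symmetry the mean equals `2c` minus itself.
  have h : ∫ t, t ∂(chiSquaredDiff c ρ) = ∫ t, (2 * c - t) ∂(chiSquaredDiff c ρ) := by
    conv_lhs => rw [← isSymmetricAround_chiSquaredDiff c ρ]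
    rw [integral_map (by fun_prop) (by fun_prop)]
  rw [integral_sub (integrable_const _) hi] at h
  simp at h
  linarith

theorem variance_chiSquaredDiff (c : ℝ) (ρ : ι → ℝ) :
    Var[fun t => t; chiSquaredDiff c ρ] = ∑ i, ρ i ^ 2 := by
  rw [chiSquaredDiff, variance_map (by fun_prop) (by fun_prop)]
  simp only [Function.comp_def]
  rw [variance_const_add (by fun_prop)]
  simp only [sum_diff_eq_sum]
  have h := variance_sum_pi (μ := fun _ : ι ⊕ ι => chiSquaredOne)
    (X := fun s q => Sum.elim (fun i => ρ i / 2) (fun i => -(ρ i / 2)) s * q)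
    fun s => (by simpa using memLp_id_chiSquaredOne 2 : MemLp (fun q : ℝ => q) 2 _).const_mul _
  rw [Finset.sum_fn] at h
  rw [h, Fintype.sum_sum_type, ← Finset.sum_add_distrib]
  refine Finset.sum_congr rfl fun i _ => ?_
  rw [variance_const_mul, variance_const_mul, variance_id_chiSquaredOne]
  simp
  ring

/-- The defining map is continuous and sends the origin to `c`, and every box around the origin has
positive mass. This is what makes the median unique, even when all the weights vanish. -/
theorem chiSquaredDiff_ball_pos (c : ℝ) (ρ : ι → ℝ) {ε : ℝ} (hε : 0 < ε) :
    0 < chiSquaredDiff c ρ (Metric.ball c ε) := by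
  let f : (ι ⊕ ι → ℝ) → ℝ := fun q => c + ∑ i, ρ i / 2 * (q (.inl i) - q (.inr i))
  have hf : Continuous f := by fun_prop
  have h0 : f ⁻¹' Metric.ball c ε ∈ nhds 0 :=
    hf.continuousAt.preimage_mem_nhds (by simpa [f] using Metric.ball_mem_nhds c hε)
  obtain ⟨δ, hδ, hsub⟩ := Metric.mem_nhds_iff.1 h0
  rw [chiSquaredDiff, Measure.map_apply hf.measurable measurableSet_ball]
  refine lt_of_lt_of_le ?_ (measure_mono hsub)
  rw [ball_pi _ hδ, Measure.pi_pi]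
  exact CanonicallyOrderedAdd.prod_pos.2 fun _ _ => chiSquaredOne_ball_pos hδ

/-- A symmetric probability measure charging every neighbourhood of its centre of symmetry has
that centre as its only median. -/
theorem IsSymmetricAround.isMedian_iff {ν : Measure ℝ} [IsProbabilityMeasure ν] {a : ℝ}
    (hsymm : IsSymmetricAround ν a) (hpos : ∀ ε > 0, 0 < ν (Metric.ball a ε)) (c : ℝ) :
    IsMedian ν c ↔ c = a := by
  have hrefl : ∀ d, ν (Set.Iic d) = ν (Set.Ici (2 * a - d)) := fun d => by
    conv_lhs => rw [← hsymm]
    rw [Measure.map_apply (by fun_prop) measurableSet_Iic]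
    congr 1
    ext t
    simp only [Set.mem_preimage, Set.mem_Iic, Set.mem_Ici]
    constructor <;> intro h <;> linarith
  -- If half of the mass lay at or below `d`, the other half would lie at or above the mirror point
  -- `2a - d`, leaving nothing for the ball around `a` in between.
  have key : ∀ d < a, ν (Set.Iic d) < 1 / 2 := by
    intro d hd
    by_contra! h
    have h2 := hrefl d
    have hdis : ν (Set.Iic d ∪ (Metric.ball a (a - d) ∪ Set.Ici (2 * a - d))) =
        ν (Set.Iic d) + (ν (Metric.ball a (a - d)) + ν (Set.Ici (2 * a - d))) := by
      rw [measure_union _ (measurableSet_ball.union measurableSet_Ici),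
        measure_union _ measurableSet_Ici]
      · rw [Set.disjoint_left]
        intro t ht ht'
        rw [Real.ball_eq_Ioo, Set.mem_Ioo] at ht
        rw [Set.mem_Ici] at ht'
        linarith
      · rw [Set.disjoint_left]
        rintro t ht (ht' | ht')
        · rw [Real.ball_eq_Ioo, Set.mem_Ioo] at ht'
          rw [Set.mem_Iic] at ht
          linarith
        · rw [Set.mem_Ici] at ht'
          rw [Set.mem_Iic] at ht
          linarith
    have hle := prob_le_one (μ := ν)
      (s := Set.Iic d ∪ (Metric.ball a (a - d) ∪ Set.Ici (2 * a - d)))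
    rw [hdis, ← h2] at hle
    have hb := hpos (a - d) (by linarith)
    have : (1 : ℝ≥0∞) < 1 := calc
      (1 : ℝ≥0∞) = 1 / 2 + 1 / 2 := (ENNReal.add_halves 1).symm
      _ < 1 / 2 + (ν (Metric.ball a (a - d)) + 1 / 2) := by
        refine ENNReal.add_lt_add_left (by simp) ?_
        rw [add_comm]
        exact ENNReal.lt_add_right (by simp) hb.ne'
      _ ≤ ν (Set.Iic d) + (ν (Metric.ball a (a - d)) + ν (Set.Iic d)) := by gcongr
      _ ≤ 1 := hle
    exact this.false
  constructor
  · rintro ⟨h1, h2⟩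
    rcases lt_trichotomy c a with h | h | h
    · exact absurd h1 (not_le.2 (key c h))
    · exact h
    · have := key (2 * a - c) (by linarith)
      rw [hrefl] at this
      exact absurd h2 (not_le.2 (by simpa using this))
  · rintro rfl
    have h := hrefl c
    rw [show 2 * c - c = c by ring] at h
    have hu : 1 ≤ ν (Set.Iic c) + ν (Set.Ici c) := by
      rw [← measure_univ (μ := ν), ← Set.Iic_union_Ici (a := c)]
      exact measure_union_le _ _
    rw [← h] at hu
    have : 1 / 2 ≤ ν (Set.Iic c) := by
      by_contra! hlt
      have := ENNReal.add_lt_add hlt hlt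
      rw [ENNReal.add_halves] at this
      exact absurd hu (not_le.2 this)
    exact ⟨this, h ▸ this⟩

end

/-! ### Densities of correlated Gaussian pairs with respect to the independent ones. -/

/-- The density of the conditional law of `y` given `x` with respect to `N(0, 1)`, for a pair of
standard Gaussian variables with correlation `r`. -/
def correlationDensity (r x y : ℝ) : ℝ :=
  (√(1 - r ^ 2))⁻¹ *
    Real.exp (-(r ^ 2 * x ^ 2 - 2 * r * (x * y) + r ^ 2 * y ^ 2) / (2 * (1 - r ^ 2)))

theorem correlationDensity_pos {r : ℝ} (hr : 0 < 1 - r ^ 2) (x y : ℝ) :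
    0 < correlationDensity r x y := by
  unfold correlationDensity
  positivity

@[fun_prop]
theorem continuous_correlationDensity (r : ℝ) :
    Continuous fun z : ℝ × ℝ => correlationDensity r z.1 z.2 := by
  unfold correlationDensity
  fun_prop

/-- The quadratic form in the exponent is diagonal in `x + y` and `x - y`. Since these have
variances `2(1 + r)` and `2(1 - r)`, normalizing them leaves the opposite weights `r/2` and `-r/2`.
-/
theorem log_correlationDensity {r : ℝ} (hr : 0 < 1 - r ^ 2) (x y : ℝ) :
    Real.log (correlationDensity r x y) = -(1 / 2) * Real.log (1 - r ^ 2) +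
      r / 2 * (((x + y) / √(2 * (1 + r))) ^ 2 - ((x - y) / √(2 * (1 - r))) ^ 2) := by
  have h1 : 0 < 1 + r := by nlinarith [sq_nonneg (1 - r), sq_nonneg (1 + r)]
  have h2 : 0 < 1 - r := by nlinarith [sq_nonneg (1 - r), sq_nonneg (1 + r)]
  rw [correlationDensity, Real.log_mul (by positivity) (Real.exp_pos _).ne', Real.log_exp,
    Real.log_inv, Real.log_sqrt hr.le, div_pow, div_pow, Real.sq_sqrt (by positivity),
    Real.sq_sqrt (by positivity), show 1 - r ^ 2 = (1 + r) * (1 - r) by ring]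
  field_simp
  ring

/-- The pushforward is `N(r x, 1 - r²)`, and `correlationDensity` is the quotient of its density by
that of `N(0, 1)`. -/
theorem map_gaussianReal_eq_withDensity {r : ℝ} (hr : 0 < 1 - r ^ 2) (x : ℝ) :
    (gaussianReal 0 1).map (fun w => r * x + √(1 - r ^ 2) * w) =
      (gaussianReal 0 1).withDensity fun y => ENNReal.ofReal (correlationDensity r x y) := by
  have hs : 0 < √(1 - r ^ 2) := Real.sqrt_pos.2 hr
  have h1 := gaussianReal_map_const_mul (μ := 0) (v := 1) (√(1 - r ^ 2))
  have h2 : (gaussianReal 0 1).map (fun w => r * x + √(1 - r ^ 2) * w) =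
      gaussianReal (r * x) (.mk (√(1 - r ^ 2) ^ 2) (sq_nonneg _)) := by
    rw [show (fun w => r * x + √(1 - r ^ 2) * w) =
      (fun w => r * x + w) ∘ fun w => √(1 - r ^ 2) * w from rfl,
      ← Measure.map_map (by fun_prop) (by fun_prop), h1, gaussianReal_map_const_add]
    simp
  have hv : (.mk (√(1 - r ^ 2) ^ 2) (sq_nonneg _) : NNReal) ≠ 0 := by
    intro h
    have := congrArg NNReal.toReal h
    simp only [NNReal.coe_mk, NNReal.coe_zero] at this
    exact (pow_pos hs 2).ne' this
  rw [h2, gaussianReal_of_var_ne_zero _ hv, gaussianReal_of_var_ne_zero _ one_ne_zero,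
    ← withDensity_mul _ (by fun_prop)
      (by unfold correlationDensity; fun_prop)]
  congr 1
  ext y
  rw [Pi.mul_apply, gaussianPDF, gaussianPDF, ← ENNReal.ofReal_mul (gaussianPDFReal_nonneg _ _ _)]
  congr 1
  simp only [gaussianPDFReal, correlationDensity, NNReal.coe_mk, NNReal.coe_one]
  rw [Real.sq_sqrt hr.le, Real.sqrt_mul (by positivity), mul_inv]
  have e : -(y - r * x) ^ 2 / (2 * (1 - r ^ 2)) = -(y - 0) ^ 2 / (2 * 1) +
      -(r ^ 2 * x ^ 2 - 2 * r * (x * y) + r ^ 2 * y ^ 2) / (2 * (1 - r ^ 2)) := by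
    field_simp
    ring
  rw [e, Real.exp_add, mul_one]
  ring_nf

/-- It suffices to compare the measures on boxes. There the integrand splits into functions of
single coordinates, which are independent under the product measure. -/
theorem pi_withDensity {ι : Type*} [Fintype ι] {α : ι → Type*} [∀ i, MeasurableSpace (α i)]
    (μ : ∀ i, Measure (α i)) [∀ i, IsProbabilityMeasure (μ i)] (f : ∀ i, α i → ℝ≥0∞)
    (hf : ∀ i, Measurable (f i)) [∀ i, SigmaFinite ((μ i).withDensity (f i))] :
    Measure.pi (fun i => (μ i).withDensity (f i)) =
      (Measure.pi μ).withDensity fun x => ∏ i, f i (x i) := by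
  refine Measure.pi_eq (μ := fun i => (μ i).withDensity (f i)) fun s hs => ?_
  rw [withDensity_apply _ (MeasurableSet.univ_pi hs),
    ← lintegral_indicator (MeasurableSet.univ_pi hs)]
  have h := lintegral_prod_eq_prod_lintegral_of_indepFun (μ := Measure.pi μ) Finset.univ
    (fun i x => (s i).indicator (f i) (x i))
    (iIndepFun_pi fun i => ((hf i).indicator (hs i)).aemeasurable)
    fun i => ((hf i).indicator (hs i)).comp (measurable_pi_apply i)
  rw [show (fun x : ∀ i, α i => (Set.univ.pi s).indicator (fun x => ∏ i, f i (x i)) x) =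
      fun x => ∏ i, (s i).indicator (f i) (x i) from ?_, h]
  · refine Finset.prod_congr rfl fun i _ => ?_
    rw [withDensity_apply _ (hs i), ← lintegral_indicator (hs i)]
    exact (measurePreserving_eval μ i).lintegral_comp ((hf i).indicator (hs i))
  · ext x
    by_cases hx : x ∈ Set.univ.pi s
    · rw [Set.indicator_of_mem hx]
      exact Finset.prod_congr rfl fun i _ => (Set.indicator_of_mem (hx i trivial) _).symm
    · rw [Set.indicator_of_notMem hx]
      simp only [Set.mem_pi, Set.mem_univ, true_imp_iff, not_forall] at hx
      obtain ⟨i, hi⟩ := hx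
      exact (Finset.prod_eq_zero (Finset.mem_univ i) (Set.indicator_of_notMem hi _)).symm

/-- If, conditionally on `x`, the coordinates `y j` are independent and jointly standard Gaussian
with `t j x` with correlation `r j`, the law of `(x, y)` has a density with respect to the product
of the marginal laws. -/
theorem prod_map_eq_withDensity {α κ : Type*} [MeasurableSpace α] [Fintype κ] (μ : Measure α)
    [IsProbabilityMeasure μ] (t : κ → α → ℝ) (ht : ∀ j, Measurable (t j)) (r : κ → ℝ)
    (hr : ∀ j, 0 < 1 - r j ^ 2) :
    (μ.prod (Measure.pi fun _ : κ => gaussianReal 0 1)).map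
        (fun z => (z.1, fun j => r j * t j z.1 + √(1 - r j ^ 2) * z.2 j)) =
      (μ.prod (Measure.pi fun _ : κ => gaussianReal 0 1)).withDensity
        fun z => ∏ j, ENNReal.ofReal (correlationDensity (r j) (t j z.1) (z.2 j)) := by
  have hm : Measurable fun z : α × (κ → ℝ) =>
      ((z.1, fun j => r j * t j z.1 + √(1 - r j ^ 2) * z.2 j) : α × (κ → ℝ)) := by
    refine measurable_fst.prodMk (measurable_pi_lambda _ fun j => ?_)
    exact (((ht j).comp measurable_fst).const_mul _).add
      (((measurable_pi_apply j).comp measurable_snd).const_mul _)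
  have hd : Measurable fun z : α × (κ → ℝ) =>
      ∏ j, ENNReal.ofReal (correlationDensity (r j) (t j z.1) (z.2 j)) := by
    refine Finset.measurable_prod _ fun j _ => Measurable.ennreal_ofReal ?_
    have h1 : Measurable fun z : α × (κ → ℝ) => t j z.1 := (ht j).comp measurable_fst
    have h2 : Measurable fun z : α × (κ → ℝ) => z.2 j :=
      (measurable_pi_apply j).comp measurable_snd
    have := (continuous_correlationDensity (r j)).measurable.comp (h1.prodMk h2)
    exact this
  -- With `x` fixed, the coordinates of the second component transform separately, so the
  -- one-dimensional formula applies to each. Integration over `x` then gives the claim.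
  have hfib : ∀ x : α, (Measure.pi fun _ : κ => gaussianReal 0 1).map
      (fun w j => r j * t j x + √(1 - r j ^ 2) * w j) =
      (Measure.pi fun _ : κ => gaussianReal 0 1).withDensity
        fun y => ∏ j, ENNReal.ofReal (correlationDensity (r j) (t j x) (y j)) := by
    intro x
    have hp : ∀ j, IsProbabilityMeasure ((gaussianReal 0 1).withDensity
        fun y => ENNReal.ofReal (correlationDensity (r j) (t j x) y)) := fun j => by
      rw [← map_gaussianReal_eq_withDensity (hr j)]
      exact Measure.isProbabilityMeasure_map (by fun_prop)
    rw [← pi_withDensity (fun _ : κ => gaussianReal 0 1)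
      (fun j y => ENNReal.ofReal (correlationDensity (r j) (t j x) y))
      (fun j => by unfold correlationDensity; fun_prop)]
    simp_rw [← map_gaussianReal_eq_withDensity (hr _)]
    exact Measure.pi_map_pi (f := fun j w => r j * t j x + √(1 - r j ^ 2) * w)
      (fun j => by fun_prop)
  ext S hS
  rw [Measure.map_apply hm hS, Measure.prod_apply (hm hS), withDensity_apply _ hS,
    ← lintegral_indicator hS, lintegral_prod _ (hd.indicator hS).aemeasurable]
  refine lintegral_congr fun x => ?_
  have hSx : MeasurableSet (Prod.mk x ⁻¹' S) := measurable_prodMk_left hS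
  have h := congrArg (fun ν => ν (Prod.mk x ⁻¹' S)) (hfib x)
  simp only at h
  rw [Measure.map_apply (by fun_prop) hSx, withDensity_apply _ hSx, ← lintegral_indicator hSx] at h
  exact h

/-! ### Singular value decomposition and canonical coordinates for covariance matrices. -/

open scoped RealInnerProductSpace in
/-- Singular value decomposition of a linear map between finite-dimensional inner product
spaces. -/
theorem exists_orthonormalBasis_singularValues {E F : Type*}
    [NormedAddCommGroup E] [InnerProductSpace ℝ E] [FiniteDimensional ℝ E]
    [NormedAddCommGroup F] [InnerProductSpace ℝ F] [FiniteDimensional ℝ F]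
    (T : E →ₗ[ℝ] F) {m n : ℕ} (hm : Module.finrank ℝ F = m) (hn : Module.finrank ℝ E = n) :
    ∃ (u : OrthonormalBasis (Fin m) ℝ F) (v : OrthonormalBasis (Fin n) ℝ E),
      ∀ i j, ⟪u i, T (v j)⟫ = if (i : ℕ) = j then T.singularValues j else 0 := by
  classical
  let hT := T.isSymmetric_adjoint_comp_self
  let v := hT.eigenvectorBasis hn
  have hv : ∀ i j : Fin n, ⟪T (v i), T (v j)⟫ = if i = j then T.singularValues j ^ 2 else 0 := by
    intro i j
    rw [← LinearMap.adjoint_inner_right, ← LinearMap.comp_apply,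
      hT.apply_eigenvectorBasis hn j, inner_smul_right, T.sq_singularValues_fin hn j,
      orthonormal_iff_ite.1 v.orthonormal i j]
    simp
  -- The vectors `T (v i) / σ i` are orthonormal where `σ i ≠ 0`, and are completed to a basis. The
  -- values of `w` at all other indices, including the default `0`, are discarded.
  let w : Fin m → F := fun i =>
    if h : (i : ℕ) < n then (T.singularValues i)⁻¹ • T (v ⟨i, h⟩) else 0
  let s : Set (Fin m) := {i | T.singularValues i ≠ 0}
  have hlt : ∀ i : ℕ, T.singularValues i ≠ 0 → i < n := by
    intro i hi
    by_contra! h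
    exact hi (T.singularValues_of_finrank_le (hn ▸ h))
  have hw : Orthonormal ℝ (s.domRestrict w) := by
    rw [orthonormal_iff_ite]
    rintro ⟨i, hi⟩ ⟨j, hj⟩
    have hi' := hlt i hi
    have hj' := hlt j hj
    change ⟪w i, w j⟫ = _
    simp only [w, hi', hj', dif_pos, inner_smul_left, inner_smul_right, hv, Fin.mk.injEq,
      Subtype.mk.injEq, Fin.val_inj]
    split_ifs with h
    · subst h
      have : T.singularValues i ≠ 0 := hi
      simp
      field_simp
    · simp
  obtain ⟨u, hu⟩ := hw.exists_orthonormalBasis_extension_of_card_eq (by simpa using hm)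
  refine ⟨u, v, fun i j => ?_⟩
  by_cases hj : T.singularValues j = 0
  · have h0 : T (v j) = 0 := by
      rw [← inner_self_eq_zero (𝕜 := ℝ), hv]
      simp [hj]
    rw [h0, inner_zero_right, hj, ite_self]
  -- There are at most `rank T ≤ m` nonzero singular values, and they come first.
  · have hjm : (j : ℕ) < m := by
      have h := T.singularValues_pos_iff_lt_finrank_range.1
        ((T.singularValues_pos_iff_ne_zero j).2 hj)
      exact h.trans_le (hm ▸ Submodule.finrank_le _)
    have huj : T (v j) = T.singularValues j • u ⟨j, hjm⟩ := by
      rw [hu ⟨j, hjm⟩ hj]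
      simp only [w, j.isLt, dif_pos]
      rw [smul_smul, mul_inv_cancel₀ hj, one_smul]
    rw [huj, inner_smul_right, orthonormal_iff_ite.1 u.orthonormal]
    simp [Fin.ext_iff]

open scoped MatrixOrder in
/-- Simultaneous reduction of two covariance matrices to the identity and of the cross-covariance
matrix to the rectangular diagonal matrix of canonical correlations. -/
theorem exists_canonical_coordinates {m n : ℕ} {A : Matrix (Fin m) (Fin m) ℝ}
    {B : Matrix (Fin n) (Fin n) ℝ} (hA : A.PosDef) (hB : B.PosDef) (C : Matrix (Fin m) (Fin n) ℝ) :
    ∃ (M : Matrix (Fin m) (Fin m) ℝ) (N : Matrix (Fin n) (Fin n) ℝ),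
      M * A * M.transpose = 1 ∧ N * B * N.transpose = 1 ∧
      M * C * N.transpose = Matrix.of fun (i : Fin m) (j : Fin n) => if (i : ℕ) = j then
        (Matrix.toEuclideanLin ((CFC.sqrt A)⁻¹ * C * (CFC.sqrt B)⁻¹)).singularValues j else 0 := by
  have hsqrt : ∀ {k : ℕ} {G : Matrix (Fin k) (Fin k) ℝ}, G.PosDef →
      CFC.sqrt G * CFC.sqrt G = G ∧ IsUnit (CFC.sqrt G).det ∧
        (CFC.sqrt G).transpose = CFC.sqrt G := by
    intro k G hG
    have h1 := CFC.sqrt_mul_sqrt_self G hG.posSemidef.nonneg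
    refine ⟨h1, ?_, ?_⟩
    · have := hG.isUnit.map Matrix.detMonoidHom
      rw [← h1] at this
      simp at this
      simpa using this
    · have := (Matrix.nonneg_iff_posSemidef.1 (CFC.sqrt_nonneg G)).isHermitian
      simpa [Matrix.IsHermitian, Matrix.conjTranspose_eq_transpose_of_trivial] using this
  have hwhite : ∀ {k : ℕ} {G : Matrix (Fin k) (Fin k) ℝ} (hG : G.PosDef)
      (u : OrthonormalBasis (Fin k) ℝ (EuclideanSpace ℝ (Fin k))),
      (Matrix.of (fun i a => u i a) * (CFC.sqrt G)⁻¹) * G *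
        (Matrix.of (fun i a => u i a) * (CFC.sqrt G)⁻¹).transpose = 1 := by
    intro k G hG u
    obtain ⟨h1, h2, h3⟩ := hsqrt hG
    have hu : Matrix.of (fun i a => u i a) * (Matrix.of (fun i a => u i a)).transpose = 1 := by
      ext i j
      have := orthonormal_iff_ite.1 u.orthonormal j i
      rw [Matrix.mul_apply, Matrix.one_apply]
      simp only [PiLp.inner_apply, RCLike.inner_apply, conj_trivial] at this
      simp only [Matrix.of_apply, Matrix.transpose_apply]
      rw [this]
      simp [eq_comm]
    rw [Matrix.transpose_mul, Matrix.transpose_nonsing_inv, h3]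
    nth_rw 2 [← h1]
    simp only [Matrix.mul_assoc]
    rw [Matrix.mul_nonsing_inv_cancel_left _ _ h2, Matrix.nonsing_inv_mul_cancel_left _ _ h2, hu]
  obtain ⟨u, v, huv⟩ := exists_orthonormalBasis_singularValues
    (Matrix.toEuclideanLin ((CFC.sqrt A)⁻¹ * C * (CFC.sqrt B)⁻¹)) (m := m) (n := n)
    (by simp) (by simp)
  -- The matrices are `U A^(-1/2)` and `V B^(-1/2)`, where the rows of `U` and `V` are the left and
  -- right singular vectors of the whitened matrix.
  refine ⟨_, _, hwhite hA u, hwhite hB v, ?_⟩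
  rw [Matrix.transpose_mul, Matrix.transpose_nonsing_inv, (hsqrt hB).2.2]
  ext i j
  rw [Matrix.of_apply, ← huv i j]
  simp only [PiLp.inner_apply, RCLike.inner_apply, conj_trivial]
  rw [show Matrix.of (fun i a => u i a) * (CFC.sqrt A)⁻¹ * C *
    ((CFC.sqrt B)⁻¹ * (Matrix.of (fun i a => v i a)).transpose) =
    Matrix.of (fun i a => u i a) * (((CFC.sqrt A)⁻¹ * C * (CFC.sqrt B)⁻¹) *
      (Matrix.of (fun i a => v i a)).transpose) by simp only [Matrix.mul_assoc], Matrix.mul_apply]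
  refine Finset.sum_congr rfl fun a _ => ?_
  rw [Matrix.of_apply, mul_comm]
  rfl

/-! ### Joint densities, pointwise mutual information and mutual information. -/

section Densities

variable {Ω : Type*} [MeasurableSpace Ω] {P : Measure Ω}

/-- A nonzero continuous linear functional of a random vector with a density has positive
variance. -/
theorem variance_pos_of_absolutelyContinuous [IsProbabilityMeasure P] {G : Type*}
    [NormedAddCommGroup G] [NormedSpace ℝ G] [FiniteDimensional ℝ G] [MeasurableSpace G]
    [BorelSpace G] {μ : Measure G} [μ.IsAddHaarMeasure] {Z : Ω → G} (hZ : AEMeasurable Z P)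
    (hac : P.map Z ≪ μ) {l : G →L[ℝ] ℝ} (hl : l ≠ 0) (hLp : MemLp (fun ω => l (Z ω)) 2 P) :
    0 < Var[fun ω => l (Z ω); P] := by
  refine lt_of_le_of_ne (variance_nonneg _ _) fun h0 => ?_
  have hconst := (ae_eq_integral_of_variance_eq_zero hLp h0.symm)
  set c := P[fun ω => l (Z ω)]
  -- Zero variance would confine `Z` almost surely to the level set `l = c`, a proper affine
  -- subspace and hence a null set.
  let S : AffineSubspace ℝ G := (AffineSubspace.mk' c ⊥).comap l.toLinearMap.toAffineMap
  have hS : (S : Set G) = {z | l z = c} := by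
    ext z
    simp [S, sub_eq_zero]
  have hne : S ≠ ⊤ := by
    intro htop
    refine hl (ContinuousLinearMap.ext fun z => ?_)
    have h1 : ∀ z, l z = c := fun z => by
      have : z ∈ (S : Set G) := by rw [htop]; trivial
      rwa [hS] at this
    rw [h1 z, ← h1 0]
    simp
  have hvol := Measure.addHaar_affineSubspace μ S hne
  have hP := hac hvol
  rw [hS, Measure.map_apply_of_aemeasurable hZ
    (measurableSet_eq_fun l.continuous.measurable measurable_const)] at hP
  have hP' : P (Z ⁻¹' {z | l z = c})ᶜ = 0 := by
    exact ae_iff.1 hconst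
  have h1 := measure_union_le (μ := P) (Z ⁻¹' {z | l z = c}) (Z ⁻¹' {z | l z = c})ᶜ
  rw [Set.union_compl_self, hP, hP', measure_univ] at h1
  simp at h1

/-- An embedding loses no information: `S` is the preimage of its own image, which is measurable, so
the identity for the pushforwards can be evaluated on that image. -/
theorem eq_withDensity_comp_of_map {E F E' F' : Type*} [MeasurableSpace E] [MeasurableSpace F]
    [MeasurableSpace E'] [MeasurableSpace F'] {μ : Measure (E × F)} {μ₁ : Measure E}
    {μ₂ : Measure F} [IsProbabilityMeasure μ₁] [IsProbabilityMeasure μ₂] {T₁ : E → E'} {T₂ : F → F'}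
    (h₁ : MeasurableEmbedding T₁) (h₂ : MeasurableEmbedding T₂) {f : E' × F' → ℝ≥0∞}
    (h : μ.map (Prod.map T₁ T₂) = ((μ₁.map T₁).prod (μ₂.map T₂)).withDensity f) :
    μ = (μ₁.prod μ₂).withDensity (f ∘ Prod.map T₁ T₂) := by
  have hT := h₁.prodMap h₂
  rw [Measure.map_prod_map _ _ h₁.measurable h₂.measurable] at h
  ext S hS
  have h' := DFunLike.congr_fun h (Prod.map T₁ T₂ '' S)
  rw [hT.map_apply, withDensity_apply _ (hT.measurableSet_image.2 hS),
    hT.restrict_map, hT.lintegral_map, Set.preimage_image_eq _ hT.injective] at h'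
  rw [h', withDensity_apply _ hS]
  rfl

variable [IsProbabilityMeasure P] {E F : Type*}
    [NormedAddCommGroup E] [NormedSpace ℝ E] [MeasureSpace E] [BorelSpace E]
    [SecondCountableTopology E] [SigmaFinite (volume : Measure E)]
    [(volume : Measure E).IsOpenPosMeasure]
    [NormedAddCommGroup F] [NormedSpace ℝ F] [MeasureSpace F] [BorelSpace F]
    [SecondCountableTopology F] [SigmaFinite (volume : Measure F)]
    [(volume : Measure F).IsOpenPosMeasure]
    {X : Ω → E} {Y : Ω → F} {h : E × F → ℝ}

/-- The pointwise mutual information is the logarithm of any density of the joint law with respect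
to the product of the marginal laws. -/
theorem pmi_ae_eq_log (hnice : HasSmoothPosDensities X Y P) (hX : AEMeasurable X P)
    (hY : AEMeasurable Y P) (hh : Measurable h) (hpos : ∀ z, 0 < h z)
    (hd : P.map (fun ω => (X ω, Y ω)) =
      ((P.map X).prod (P.map Y)).withDensity fun z => ENNReal.ofReal (h z)) :
    (fun ω => pmi X Y P (X ω, Y ω)) =ᵐ[P] fun ω => Real.log (h (X ω, Y ω)) := by
  obtain ⟨p, hp⟩ := hnice.joint
  obtain ⟨p₁, hp₁⟩ := hnice.fst
  obtain ⟨p₂, hp₂⟩ := hnice.snd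
  have m := hp.contDiff.continuous.measurable.ennreal_ofReal
  have m₁ := hp₁.contDiff.continuous.measurable.ennreal_ofReal
  have m₂ := hp₂.contDiff.continuous.measurable.ennreal_ofReal
  have m₁₂ : Measurable fun z : E × F => ENNReal.ofReal (p₁ z.1) * ENNReal.ofReal (p₂ z.2) :=
    (m₁.comp measurable_fst).mul (m₂.comp measurable_snd)
  have := Measure.isProbabilityMeasure_map (μ := P) hX
  have := Measure.isProbabilityMeasure_map (μ := P) hY
  have : SigmaFinite (volume.withDensity fun x => ENNReal.ofReal (p₁ x)) := by
    rw [← hp₁.eq_withDensity]; infer_instance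
  have : SigmaFinite (volume.withDensity fun x => ENNReal.ofReal (p₂ x)) := by
    rw [← hp₂.eq_withDensity]; infer_instance
  -- Both sides are densities of the joint law with respect to `volume`. They need only agree almost
  -- everywhere, because the joint law is absolutely continuous.
  have e : p =ᵐ[volume] fun z => p₁ z.1 * p₂ z.2 * h z := by
    have h1 := hd
    rw [hp.eq_withDensity, hp₁.eq_withDensity, hp₂.eq_withDensity, prod_withDensity m₁ m₂,
      ← withDensity_mul _ m₁₂ hh.ennreal_ofReal, ← Measure.volume_eq_prod,
      withDensity_eq_iff_of_sigmaFinite m.aemeasurable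
        (m₁₂.mul hh.ennreal_ofReal).aemeasurable] at h1
    filter_upwards [h1] with z hz
    rw [Pi.mul_apply, ← ENNReal.ofReal_mul (hp₁.pos _).le,
      ← ENNReal.ofReal_mul (mul_pos (hp₁.pos _) (hp₂.pos _)).le] at hz
    exact (ENNReal.ofReal_eq_ofReal_iff (hp.pos z).le
      (mul_pos (mul_pos (hp₁.pos _) (hp₂.pos _)) (hpos z)).le).1 hz
  have hac : P.map (fun ω => (X ω, Y ω)) ≪ volume := by
    rw [hp.eq_withDensity]
    exact withDensity_absolutelyContinuous _ _
  have e' := ae_of_ae_map (hX.prodMk hY) (hac.ae_le e)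
  filter_upwards [e'] with ω hω
  rw [pmi, hp.smoothDensity_eq, hp₁.smoothDensity_eq, hp₂.smoothDensity_eq, hω,
    mul_div_cancel_left₀ _ (mul_pos (hp₁.pos _) (hp₂.pos _)).ne']


end Densities

section MutualInfo

variable {Ω E F : Type*} [MeasurableSpace Ω] [MeasurableSpace E] [MeasurableSpace F]
  {P : Measure Ω} [IsProbabilityMeasure P] {X : Ω → E} {Y : Ω → F} {h : E × F → ℝ}

/-- Here `h` is the Radon-Nikodym derivative of the joint law, so the log-likelihood ratio
integrated by the divergence is `log h`. -/
theorem mutualInfo_eq_integral_log (hX : AEMeasurable X P)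
    (hY : AEMeasurable Y P) (hh : Measurable h) (hpos : ∀ z, 0 < h z)
    (hd : P.map (fun ω => (X ω, Y ω)) =
      ((P.map X).prod (P.map Y)).withDensity fun z => ENNReal.ofReal (h z))
    (hint : Integrable (fun ω => Real.log (h (X ω, Y ω))) P) :
    mutualInfo X Y P ≠ ∞ ∧
      (mutualInfo X Y P).toReal = ∫ ω, Real.log (h (X ω, Y ω)) ∂P := by
  have := Measure.isProbabilityMeasure_map (μ := P) hX
  have := Measure.isProbabilityMeasure_map (μ := P) hY
  have := Measure.isProbabilityMeasure_map (μ := P) (hX.prodMk hY)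
  have hac : P.map (fun ω => (X ω, Y ω)) ≪ (P.map X).prod (P.map Y) := by
    rw [hd]
    exact withDensity_absolutelyContinuous _ _
  have hr := Measure.rnDeriv_withDensity ((P.map X).prod (P.map Y)) hh.ennreal_ofReal
  rw [← hd] at hr
  have hllr : llr (P.map fun ω => (X ω, Y ω)) ((P.map X).prod (P.map Y))
      =ᵐ[P.map fun ω => (X ω, Y ω)] fun z => Real.log (h z) := by
    filter_upwards [hac.ae_le hr] with z hz
    rw [llr, hz, ENNReal.toReal_ofReal (hpos z).le]
  have hi : Integrable (llr (P.map fun ω => (X ω, Y ω)) ((P.map X).prod (P.map Y)))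
      (P.map fun ω => (X ω, Y ω)) := by
    refine Integrable.congr ?_ hllr.symm
    exact (integrable_map_measure (Real.measurable_log.comp hh).aestronglyMeasurable
      (hX.prodMk hY)).2 hint
  refine ⟨InformationTheory.klDiv_ne_top hac hi, ?_⟩
  rw [mutualInfo, InformationTheory.toReal_klDiv_of_measure_eq hac (by simp),
    integral_congr_ae hllr]
  exact integral_map (hX.prodMk hY) (Real.measurable_log.comp hh).aestronglyMeasurable

end MutualInfo

/-! ### Gaussian pairs in canonical coordinates. -/

/-- Centred jointly Gaussian vectors `x`, `y` in canonical coordinates: all coordinates have unit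
variance and the only correlations are `cov(x_j, y_j) = σ j`. -/
structure IsCanonicalPair {Ω : Type*} [MeasurableSpace Ω] {m n : ℕ} (x : Fin m → Ω → ℝ)
    (y : Fin n → Ω → ℝ) (σ : ℕ → ℝ) (P : Measure Ω) : Prop where
  gaussian : HasGaussianLaw (fun ω (s : Fin m ⊕ Fin n) => Sum.elim x y s ω) P
  mean_left : ∀ i, P[x i] = 0
  mean_right : ∀ j, P[y j] = 0
  cov_left : ∀ i i', cov[x i, x i'; P] = if i = i' then 1 else 0
  cov_right : ∀ j j', cov[y j, y j'; P] = if j = j' then 1 else 0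
  cov_cross : ∀ i j, cov[x i, y j; P] = if (i : ℕ) = j then σ j else 0
  one_sub_sq_pos : ∀ j, 0 < 1 - σ j ^ 2
  eq_zero : ∀ j, min m n ≤ j → σ j = 0

/-- Uncorrelated coordinates of a Gaussian vector are independent, and a Gaussian variable is
determined by its mean and variance. -/
theorem iIndepFun_and_hasLaw_of_cov {Ω τ : Type*} [MeasurableSpace Ω] [Fintype τ] [DecidableEq τ]
    {P : Measure Ω} {W : τ → Ω → ℝ} (hW : HasGaussianLaw (fun ω s => W s ω) P)
    (h0 : ∀ s, P[W s] = 0) (hc : ∀ s t, cov[W s, W t; P] = if s = t then 1 else 0) :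
    iIndepFun W P ∧ ∀ s, HasLaw (W s) (gaussianReal 0 1) P := by
  refine ⟨hW.iIndepFun_of_covariance_eq_zero fun s t hst => by rw [hc, if_neg hst], fun s => ?_⟩
  have hs := hW.eval s
  refine ⟨hs.aemeasurable, ?_⟩
  rw [hs.map_eq_gaussianReal, h0, ← covariance_self hs.aemeasurable, hc]
  simp

/-- The coordinate of index `j` of a vector of length `m`, and `0` beyond its length. -/
def coordOrZero {m : ℕ} (j : ℕ) (a : Fin m → ℝ) : ℝ := if h : j < m then a ⟨j, h⟩ else 0

/-- `coordOrZero` as a continuous linear map. -/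
def coordOrZeroL (m j : ℕ) : (Fin m → ℝ) →L[ℝ] ℝ :=
  if h : j < m then ContinuousLinearMap.proj ⟨j, h⟩ else 0

theorem coordOrZeroL_apply {m : ℕ} (j : ℕ) (a : Fin m → ℝ) :
    coordOrZeroL m j a = coordOrZero j a := by
  unfold coordOrZeroL coordOrZero
  split_ifs <;> simp

@[fun_prop]
theorem continuous_coordOrZero {m : ℕ} (j : ℕ) :
    Continuous (coordOrZero j : (Fin m → ℝ) → ℝ) := by
  simp_rw [← funext (coordOrZeroL_apply (m := m) j)]
  exact (coordOrZeroL m j).continuous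

namespace IsCanonicalPair

variable {Ω : Type*} [MeasurableSpace Ω] {m n : ℕ} {x : Fin m → Ω → ℝ} {y : Fin n → Ω → ℝ}
  {σ : ℕ → ℝ} {P : Measure Ω}

theorem memLp_left (h : IsCanonicalPair x y σ P) (i : Fin m) : MemLp (x i) 2 P :=
  (h.gaussian.eval (.inl i)).memLp_two

theorem memLp_right (h : IsCanonicalPair x y σ P) (j : Fin n) : MemLp (y j) 2 P :=
  (h.gaussian.eval (.inr j)).memLp_two

theorem isProbabilityMeasure (h : IsCanonicalPair x y σ P) : IsProbabilityMeasure P :=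
  h.gaussian.isProbabilityMeasure

theorem memLp_coordOrZero (h : IsCanonicalPair x y σ P) (j : ℕ) :
    MemLp (fun ω => coordOrZero j fun i => x i ω) 2 P := by
  unfold coordOrZero
  split_ifs with hj
  · exact h.memLp_left _
  · exact MemLp.zero

theorem mean_coordOrZero (h : IsCanonicalPair x y σ P) (j : ℕ) :
    P[fun ω => coordOrZero j fun i => x i ω] = 0 := by
  unfold coordOrZero
  split_ifs with hj
  · exact h.mean_left _
  · simp

theorem cov_coordOrZero_left (h : IsCanonicalPair x y σ P) (i : Fin m) (j : ℕ) :
    cov[x i, fun ω => coordOrZero j fun i => x i ω; P] = if (i : ℕ) = j then 1 else 0 := by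
  have := h.isProbabilityMeasure
  unfold coordOrZero
  split_ifs with hj hij hij
  · rw [h.cov_left, if_pos (Fin.ext hij)]
  · rw [h.cov_left, if_neg (fun e => hij (by rw [e]))]
  · exact absurd (hij ▸ i.isLt) hj
  · simp

theorem cov_coordOrZero_right (h : IsCanonicalPair x y σ P) (j : ℕ) (j' : Fin n) :
    cov[fun ω => coordOrZero j fun i => x i ω, y j'; P] = if j = j' then σ j' else 0 := by
  have := h.isProbabilityMeasure
  unfold coordOrZero
  split_ifs with hj hij hij
  · rw [h.cov_cross, if_pos hij]
  · rw [h.cov_cross, if_neg hij]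
  · rw [covariance_const_left, h.eq_zero]
    exact (min_le_left _ _).trans (hij ▸ not_lt.1 hj)
  · simp

/-- The factors `σ` make the formula uniform in `j`: beyond the length of `x` the variance of the
padded coordinate is `0` rather than `1`, but `σ j` vanishes there too. -/
theorem cov_coordOrZero_coordOrZero (h : IsCanonicalPair x y σ P) (j j' : ℕ) :
    σ j * (σ j' * cov[fun ω => coordOrZero j fun i => x i ω,
      fun ω => coordOrZero j' fun i => x i ω; P]) = if j = j' then σ j ^ 2 else 0 := by
  have := h.isProbabilityMeasure
  by_cases hj : j < m
  · have : (fun ω => coordOrZero j fun i => x i ω) = x ⟨j, hj⟩ := by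
      ext ω
      simp [coordOrZero, hj]
    rw [this, h.cov_coordOrZero_left]
    split_ifs with e
    · simp only at e
      rw [e]
      ring
    · simp
  · rw [h.eq_zero j ((min_le_left _ _).trans (not_lt.1 hj))]
    simp

/-- The part of `y j` that is independent of `x`, normalized. -/
def residual (x : Fin m → Ω → ℝ) (y : Fin n → Ω → ℝ) (σ : ℕ → ℝ) (j : Fin n) (ω : Ω) : ℝ :=
  (y j ω - σ j * coordOrZero j fun i => x i ω) / √(1 - σ j ^ 2)

/-- Gaussian regression: subtracting `σ j x_j` from `y_j` removes its covariance with `x` and leaves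
variance `1 - σ j ^ 2`. -/
theorem iIndepFun_residual (h : IsCanonicalPair x y σ P) :
    iIndepFun (Sum.elim x (residual x y σ)) P ∧
      ∀ s, HasLaw (Sum.elim x (residual x y σ) s) (gaussianReal 0 1) P := by
  have := h.isProbabilityMeasure
  have ht := fun j => h.memLp_coordOrZero j
  have hpos : ∀ j : ℕ, 0 < √(1 - σ j ^ 2) := fun j => Real.sqrt_pos.2 (h.one_sub_sq_pos j)
  have hcross : ∀ i j, cov[x i, residual x y σ j; P] = 0 := by
    intro i j
    unfold residual
    rw [covariance_fun_div_right, covariance_fun_sub_right (h.memLp_left i) (h.memLp_right j)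
      ((ht j).const_mul _), covariance_const_mul_right, h.cov_cross, h.cov_coordOrZero_left]
    split_ifs <;> simp
  refine iIndepFun_and_hasLaw_of_cov ?_ ?_ ?_
  · let pl : Fin m → (Fin m ⊕ Fin n → ℝ) →L[ℝ] ℝ := fun i =>
      ContinuousLinearMap.proj (R := ℝ) (φ := fun _ => ℝ) (Sum.inl i)
    let pr : Fin n → (Fin m ⊕ Fin n → ℝ) →L[ℝ] ℝ := fun j =>
      ContinuousLinearMap.proj (R := ℝ) (φ := fun _ => ℝ) (Sum.inr j)
    let L : (Fin m ⊕ Fin n → ℝ) →L[ℝ] (Fin m ⊕ Fin n → ℝ) := ContinuousLinearMap.pi <|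
      Sum.elim pl fun j => (√(1 - σ j ^ 2))⁻¹ •
        (pr j - σ j • (coordOrZeroL m j).comp (ContinuousLinearMap.pi pl))
    refine (h.gaussian.map_fun L).congr (.of_forall fun ω => funext fun s => ?_)
    rcases s with i | j
    · simp [L, pl]
    · simp [L, pl, pr, coordOrZeroL_apply, residual]
      ring
  · rintro (i | j)
    · exact h.mean_left i
    · simp only [Sum.elim_inr]
      unfold residual
      rw [integral_div, integral_sub ((h.memLp_right j).integrable one_le_two)
        (((ht j).integrable one_le_two).const_mul _), integral_const_mul, h.mean_coordOrZero,
        h.mean_right]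
      simp
  · rintro (i | j) (i' | j')
    · simp [h.cov_left]
    · simp [hcross]
    · simp [covariance_comm _ (x i'), hcross]
    · simp only [Sum.elim_inr, Sum.inr.injEq]
      unfold residual
      rw [covariance_fun_div_left, covariance_fun_div_right,
        covariance_fun_sub_fun_sub (h.memLp_right j) ((ht j).const_mul _) (h.memLp_right j')
        ((ht j').const_mul _), h.cov_right, covariance_const_mul_right, covariance_const_mul_left,
        covariance_const_mul_left, covariance_const_mul_right,
        h.cov_coordOrZero_right, covariance_comm, h.cov_coordOrZero_right,
        h.cov_coordOrZero_coordOrZero]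
      by_cases e : j = j'
      · subst e
        have := Real.mul_self_sqrt (h.one_sub_sq_pos j).le
        have := (hpos j).ne'
        simp only [if_true]
        field_simp
        rw [Real.sq_sqrt (h.one_sub_sq_pos j).le]
        ring
      · have e' : (j : ℕ) ≠ j' := fun he => e (Fin.ext he)
        simp [e, e', e'.symm]

theorem map_left (h : IsCanonicalPair x y σ P) :
    P.map (fun ω i => x i ω) = Measure.pi fun _ => gaussianReal 0 1 :=
  (iIndepFun.hasLaw_pi (X := x) (fun i => h.iIndepFun_residual.2 (.inl i)) <|
    h.iIndepFun_residual.1.precomp (g := Sum.inl) Sum.inl_injective).map_eq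

theorem map_right (h : IsCanonicalPair x y σ P) :
    P.map (fun ω j => y j ω) = Measure.pi fun _ => gaussianReal 0 1 := by
  have h' := iIndepFun_and_hasLaw_of_cov (W := y)
    (h.gaussian.map_fun (ContinuousLinearMap.pi fun j : Fin n =>
      ContinuousLinearMap.proj (R := ℝ) (φ := fun _ : Fin m ⊕ Fin n => ℝ) (Sum.inr j)))
    h.mean_right h.cov_right
  exact (h'.1.hasLaw_pi h'.2).map_eq

/-- The density of the joint law with respect to the product of the marginal laws. -/
def density (σ : ℕ → ℝ) (z : (Fin m → ℝ) × (Fin n → ℝ)) : ℝ :=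
  ∏ j : Fin n, correlationDensity (σ j) (coordOrZero j z.1) (z.2 j)

theorem measurable_density :
    Measurable (density σ : (Fin m → ℝ) × (Fin n → ℝ) → ℝ) := by
  unfold density
  refine Finset.measurable_prod _ fun j _ => ?_
  have h1 : Measurable fun z : (Fin m → ℝ) × (Fin n → ℝ) => coordOrZero (j : ℕ) z.1 :=
    (continuous_coordOrZero (j : ℕ)).measurable.comp measurable_fst
  have h2 : Measurable fun z : (Fin m → ℝ) × (Fin n → ℝ) => z.2 j :=
    (measurable_pi_apply j).comp measurable_snd
  have := (continuous_correlationDensity (σ j)).measurable.comp (h1.prodMk h2)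
  exact this

/-- Writing `y_j = σ j x_j + √(1 - σ j ^ 2) · residual_j` exhibits `(x, y)` as the image of a
standard Gaussian pair under the map of `prod_map_eq_withDensity`. The product of the marginals is
that same standard Gaussian law. -/
theorem map_prod (h : IsCanonicalPair x y σ P) :
    P.map (fun ω => ((fun i => x i ω), fun j => y j ω)) =
      ((P.map fun ω i => x i ω).prod (P.map fun ω j => y j ω)).withDensity
        fun z => ENNReal.ofReal (density σ z) := by
  have := h.isProbabilityMeasure
  obtain ⟨hind, hlaw⟩ := h.iIndepFun_residual
  have hr : HasLaw (fun ω j => residual x y σ j ω) (Measure.pi fun _ : Fin n => gaussianReal 0 1)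
      P := iIndepFun.hasLaw_pi (fun j => hlaw (.inr j)) (hind.precomp (g := Sum.inr) Sum.inr_injective)
  have hx : HasLaw (fun ω i => x i ω) (Measure.pi fun _ : Fin m => gaussianReal 0 1) P :=
    iIndepFun.hasLaw_pi (fun i => hlaw (.inl i)) (hind.precomp (g := Sum.inl) Sum.inl_injective)
  have hxr : IndepFun (fun ω i => x i ω) (fun ω j => residual x y σ j ω) P := by
    have h1 := hind.indepFun_finset₀ (Finset.univ.map ⟨Sum.inl, Sum.inl_injective⟩)
      (Finset.univ.map ⟨Sum.inr, Sum.inr_injective⟩) (by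
        rw [Finset.disjoint_left]
        simp) (fun s => (hlaw s).aemeasurable)
    exact h1.comp
      (φ := fun (a : Finset.univ.map ⟨Sum.inl, Sum.inl_injective⟩ → ℝ) (i : Fin m) =>
        a ⟨Sum.inl i, by simp⟩)
      (ψ := fun (a : Finset.univ.map ⟨Sum.inr, Sum.inr_injective⟩ → ℝ) (j : Fin n) =>
        a ⟨Sum.inr j, by simp⟩)
      (by fun_prop) (by fun_prop)
  have hjoint := (indepFun_iff_hasLaw_prodMk_prod hx hr).1 hxr
  have key := prod_map_eq_withDensity (Measure.pi fun _ : Fin m => gaussianReal 0 1)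
    (fun (j : Fin n) => coordOrZero (j : ℕ)) (fun j => by fun_prop) (fun j => σ j)
    (fun j => h.one_sub_sq_pos j)
  rw [h.map_left, h.map_right]
  simp_rw [density, ENNReal.ofReal_prod_of_nonneg
    (fun j _ => (correlationDensity_pos (h.one_sub_sq_pos _) _ _).le)]
  rw [← key, ← hjoint.map_eq, AEMeasurable.map_map_of_aemeasurable _ hjoint.aemeasurable]
  · congr 1
    ext ω j
    · rfl
    · have := (Real.sqrt_pos.2 (h.one_sub_sq_pos j)).ne'
      simp only [Function.comp_apply, residual]
      field_simp
      ring
  · fun_prop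

/-- The normalized sums `(x i + y i) / √(2 (1 + σ i))`. -/
def normalizedAdd (x : Fin m → Ω → ℝ) (y : Fin n → Ω → ℝ) (σ : ℕ → ℝ) (i : Fin (min m n)) (ω : Ω) :
    ℝ :=
  (x (i.castLE (min_le_left m n)) ω + y (i.castLE (min_le_right m n)) ω) / √(2 * (1 + σ i))

/-- The normalized differences `(x i - y i) / √(2 (1 - σ i))`. -/
def normalizedSub (x : Fin m → Ω → ℝ) (y : Fin n → Ω → ℝ) (σ : ℕ → ℝ) (i : Fin (min m n)) (ω : Ω) :
    ℝ :=
  (x (i.castLE (min_le_left m n)) ω - y (i.castLE (min_le_right m n)) ω) / √(2 * (1 - σ i))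

/-- Sum and difference of two variables of equal variance are uncorrelated; here their variances are
`2(1 + σ i)` and `2(1 - σ i)`. -/
theorem iIndepFun_normalized (h : IsCanonicalPair x y σ P) :
    iIndepFun (Sum.elim (normalizedAdd x y σ) (normalizedSub x y σ)) P ∧
      ∀ s, HasLaw (Sum.elim (normalizedAdd x y σ) (normalizedSub x y σ) s)
        (gaussianReal 0 1) P := by
  have := h.isProbabilityMeasure
  have h1 : ∀ j, 0 < 1 + σ j := fun j => by
    nlinarith [h.one_sub_sq_pos j, sq_nonneg (1 - σ j), sq_nonneg (1 + σ j)]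
  have h2 : ∀ j, 0 < 1 - σ j := fun j => by
    nlinarith [h.one_sub_sq_pos j, sq_nonneg (1 - σ j), sq_nonneg (1 + σ j)]
  have ix := fun i => (h.memLp_left i).integrable one_le_two
  have iy := fun i => (h.memLp_right i).integrable one_le_two
  have cadd : ∀ {U V Z W : Ω → ℝ}, MemLp U 2 P → MemLp V 2 P → MemLp Z 2 P → MemLp W 2 P →
      cov[fun ω => U ω + V ω, fun ω => Z ω + W ω; P] =
        cov[U, Z; P] + cov[U, W; P] + (cov[V, Z; P] + cov[V, W; P]) := by
    intro U V Z W hU hV hZ hW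
    rw [← covariance_add_right hU hZ hW, ← covariance_add_right hV hZ hW]
    exact covariance_add_left hU hV (hZ.add hW)
  have csub : ∀ {U V Z W : Ω → ℝ}, MemLp U 2 P → MemLp V 2 P → MemLp Z 2 P → MemLp W 2 P →
      cov[fun ω => U ω + V ω, fun ω => Z ω - W ω; P] =
        cov[U, Z; P] - cov[U, W; P] + (cov[V, Z; P] - cov[V, W; P]) := by
    intro U V Z W hU hV hZ hW
    rw [← covariance_sub_right hU hZ hW, ← covariance_sub_right hV hZ hW]
    exact covariance_add_left hU hV (hZ.sub hW)
  have hcross : ∀ i i', cov[normalizedAdd x y σ i, normalizedSub x y σ i'; P] = 0 := by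
    intro i i'
    unfold normalizedAdd normalizedSub
    rw [covariance_fun_div_left, covariance_fun_div_right,
      csub (h.memLp_left _) (h.memLp_right _) (h.memLp_left _) (h.memLp_right _)]
    simp only [ h.cov_left, h.cov_right, h.cov_cross,
      covariance_comm (y _) (x _)]
    by_cases e : i = i'
    · subst e
      simp
    · have e' : (i : ℕ) ≠ i' := fun he => e (Fin.ext he)
      simp [Fin.ext_iff, e', e'.symm]
  refine iIndepFun_and_hasLaw_of_cov ?_ ?_ ?_
  · let pl : Fin m → (Fin m ⊕ Fin n → ℝ) →L[ℝ] ℝ := fun i =>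
      ContinuousLinearMap.proj (R := ℝ) (φ := fun _ => ℝ) (Sum.inl i)
    let pr : Fin n → (Fin m ⊕ Fin n → ℝ) →L[ℝ] ℝ := fun j =>
      ContinuousLinearMap.proj (R := ℝ) (φ := fun _ => ℝ) (Sum.inr j)
    let L : (Fin m ⊕ Fin n → ℝ) →L[ℝ] (Fin (min m n) ⊕ Fin (min m n) → ℝ) :=
      ContinuousLinearMap.pi <| Sum.elim
        (fun i => (√(2 * (1 + σ i)))⁻¹ •
          (pl (i.castLE (min_le_left m n)) +
            pr (i.castLE (min_le_right m n))))
        (fun i => (√(2 * (1 - σ i)))⁻¹ •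
          (pl (i.castLE (min_le_left m n)) -
            pr (i.castLE (min_le_right m n))))
    refine (h.gaussian.map_fun L).congr (.of_forall fun ω => funext fun s => ?_)
    rcases s with i | i
    · simp only [L, pl, pr, normalizedAdd, Sum.elim_inl, ContinuousLinearMap.coe_pi',
        smul_apply, add_apply,
        ContinuousLinearMap.proj_apply, Sum.elim_inr, smul_eq_mul]
      ring
    · simp only [L, pl, pr, normalizedSub, Sum.elim_inl, ContinuousLinearMap.coe_pi',
        smul_apply, sub_apply,
        ContinuousLinearMap.proj_apply, Sum.elim_inr, smul_eq_mul]
      ring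
  · rintro (i | i)
    · simp only [Sum.elim_inl]
      unfold normalizedAdd
      rw [integral_div, integral_add (ix _) (iy _), h.mean_left, h.mean_right]
      simp
    · simp only [Sum.elim_inr]
      unfold normalizedSub
      rw [integral_div, integral_sub (ix _) (iy _), h.mean_left, h.mean_right]
      simp
  · rintro (i | i) (i' | i')
    · simp only [Sum.elim_inl, Sum.inl.injEq]
      unfold normalizedAdd
      rw [covariance_fun_div_left, covariance_fun_div_right,
        cadd (h.memLp_left _) (h.memLp_right _) (h.memLp_left _) (h.memLp_right _)]
      simp only [h.cov_left, h.cov_right, h.cov_cross, covariance_comm (y _) (x _)]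
      by_cases e : i = i'
      · subst e
        simp only [if_true, Fin.val_castLE]
        rw [div_div, Real.mul_self_sqrt (by linarith [h1 i]), div_eq_one_iff_eq
          (by linarith [h1 i])]
        ring
      · have e' : (i : ℕ) ≠ i' := fun he => e (Fin.ext he)
        simp [Fin.ext_iff, e', e'.symm]
    · simp [hcross]
    · simp only [Sum.elim_inl, Sum.elim_inr]
      rw [covariance_comm, hcross]
      simp
    · simp only [Sum.elim_inr, Sum.inr.injEq]
      unfold normalizedSub
      rw [covariance_fun_div_left, covariance_fun_div_right,
        covariance_fun_sub_fun_sub (h.memLp_left _) (h.memLp_right _) (h.memLp_left _)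
          (h.memLp_right _)]
      simp only [h.cov_left, h.cov_right, h.cov_cross, covariance_comm (y _) (x _)]
      by_cases e : i = i'
      · subst e
        simp only [if_true, Fin.val_castLE]
        rw [div_div, Real.mul_self_sqrt (by linarith [h2 i]), div_eq_one_iff_eq
          (by linarith [h2 i])]
        ring
      · have e' : (i : ℕ) ≠ i' := fun he => e (Fin.ext he)
        simp [Fin.ext_iff, e', e'.symm]

theorem log_density (h : IsCanonicalPair x y σ P) (ω : Ω) :
    Real.log (density σ ((fun i => x i ω), fun j => y j ω)) =
      -(1 / 2) * ∑ i : Fin (min m n), Real.log (1 - σ i ^ 2) + ∑ i : Fin (min m n),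
        σ i / 2 * (normalizedAdd x y σ i ω ^ 2 - normalizedSub x y σ i ω ^ 2) := by
  rw [density, Real.log_prod
    (fun j _ => (correlationDensity_pos (h.one_sub_sq_pos _) _ _).ne')]
  simp_rw [log_correlationDensity (h.one_sub_sq_pos _)]
  rw [Finset.mul_sum, ← Finset.sum_add_distrib]
  symm
  -- The density has `n` factors, but those of index at least `min m n` have `σ j = 0` and
  -- contribute nothing to the logarithm.
  refine Fintype.sum_of_injective (Fin.castLE (min_le_right m n)) (Fin.castLE_injective _) _ _
    (fun j hj => ?_) fun i => ?_
  · rw [h.eq_zero j]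
    · simp
    · by_contra! hlt
      exact hj ⟨⟨j, hlt⟩, rfl⟩
  · have hi : (i : ℕ) < m := i.isLt.trans_le (min_le_left m n)
    simp only [Fin.val_castLE, coordOrZero, hi, dif_pos, normalizedAdd, normalizedSub]
    rfl

theorem hasLaw_log_density (h : IsCanonicalPair x y σ P) :
    HasLaw (fun ω => Real.log (density σ ((fun i => x i ω), fun j => y j ω)))
      (chiSquaredDiff (-(1 / 2) * ∑ i : Fin (min m n), Real.log (1 - σ i ^ 2))
        fun i : Fin (min m n) => σ i) P := by
  simp_rw [h.log_density]
  obtain ⟨hind, hlaw⟩ := h.iIndepFun_normalized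
  have hsq : HasLaw (fun z : ℝ => z ^ 2) chiSquaredOne (gaussianReal 0 1) := ⟨by fun_prop, rfl⟩
  refine hasLaw_chiSquaredDiff _ _ (fun i => hsq.fun_comp (hlaw (.inl i)))
    (fun i => hsq.fun_comp (hlaw (.inr i))) ?_
  convert hind.comp (fun _ z => z ^ 2) (fun _ => by fun_prop) using 1
  ext (i | i) ω <;> rfl

end IsCanonicalPair

/-! ### Reduction to canonical coordinates and conclusion. -/

/-- The linear form `z ↦ ∑ a, p a * z a`. -/
def linearForm {m : ℕ} (p : Fin m → ℝ) : EuclideanSpace ℝ (Fin m) →L[ℝ] ℝ :=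
  ∑ a, p a • EuclideanSpace.proj a

theorem linearForm_apply {m : ℕ} (p : Fin m → ℝ) (z : EuclideanSpace ℝ (Fin m)) :
    linearForm p z = ∑ a, p a * z a := by
  simp [linearForm]

theorem linearForm_ne_zero {m : ℕ} {p : Fin m → ℝ} (hp : p ≠ 0) : linearForm p ≠ 0 := by
  obtain ⟨a, ha⟩ := Function.ne_iff.1 hp
  intro h
  apply ha
  have := DFunLike.congr_fun h (EuclideanSpace.single a 1)
  simpa [linearForm_apply] using this

theorem memLp_linearForm {Ω : Type*} [MeasurableSpace Ω] {P : Measure Ω} {m : ℕ}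
    {X : Ω → EuclideanSpace ℝ (Fin m)} (hX : HasGaussianLaw X P) (p : Fin m → ℝ) :
    MemLp (fun ω => linearForm p (X ω)) 2 P :=
  (hX.map_fun (linearForm p)).memLp_two

section

variable {Ω : Type*} [MeasurableSpace Ω] {P : Measure Ω} [IsProbabilityMeasure P] {m n : ℕ}
  {X : Ω → EuclideanSpace ℝ (Fin m)} {Y : Ω → EuclideanSpace ℝ (Fin n)}

theorem covariance_linearForm (hX : HasGaussianLaw X P) (hY : HasGaussianLaw Y P)
    (p : Fin m → ℝ) (q : Fin n → ℝ) :
    cov[fun ω => linearForm p (X ω), fun ω => linearForm q (Y ω); P] =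
      ∑ a, ∑ b, p a * crossCov X Y P a b * q b := by
  simp_rw [linearForm_apply]
  have hXa : ∀ a, MemLp (fun ω => X ω a) 2 P := fun a =>
    (hX.map_fun (EuclideanSpace.proj (𝕜 := ℝ) a)).memLp_two
  have hYb : ∀ b, MemLp (fun ω => Y ω b) 2 P := fun b =>
    (hY.map_fun (EuclideanSpace.proj (𝕜 := ℝ) b)).memLp_two
  rw [covariance_fun_sum_fun_sum (fun a => (hXa a).const_mul _) (fun b => (hYb b).const_mul _)]
  refine Finset.sum_congr rfl fun a _ => Finset.sum_congr rfl fun b _ => ?_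
  rw [covariance_const_mul_left, covariance_const_mul_right, crossCov, Matrix.of_apply]
  ring

theorem covariance_linearForm_eq_mul (hX : HasGaussianLaw X P) (hY : HasGaussianLaw Y P)
    {k l : ℕ} (M : Matrix (Fin k) (Fin m) ℝ) (N : Matrix (Fin l) (Fin n) ℝ) (i : Fin k)
    (j : Fin l) :
    cov[fun ω => linearForm (M i) (X ω), fun ω => linearForm (N j) (Y ω); P] =
      (M * crossCov X Y P * N.transpose) i j := by
  rw [covariance_linearForm hX hY, Finset.sum_comm, Matrix.mul_apply]
  refine Finset.sum_congr rfl fun b _ => ?_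
  rw [Matrix.mul_apply, Finset.sum_mul]
  rfl

theorem posDef_crossCov (hX : HasGaussianLaw X P)
    (hpos : ∀ p : Fin m → ℝ, p ≠ 0 → 0 < Var[fun ω => linearForm p (X ω); P]) :
    (crossCov X X P).PosDef := by
  rw [Matrix.posDef_iff_dotProduct_mulVec]
  refine ⟨?_, fun p hp => ?_⟩
  · ext i j
    simp [crossCov, covariance_comm]
  · have h := hpos p hp
    rw [← covariance_self (memLp_linearForm hX p).aestronglyMeasurable.aemeasurable,
      covariance_linearForm hX hX] at h
    have e : dotProduct p ((crossCov X X P).mulVec p) =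
        ∑ a, ∑ b, p a * crossCov X X P a b * p b := by
      simp [dotProduct, Matrix.mulVec, Finset.mul_sum, mul_assoc]
    rwa [star_trivial, e]

/-- A one-sided inverse of a square matrix makes it invertible. Injectivity together with continuity
makes the change of coordinates a measurable embedding. -/
theorem linearForm_injective {M N : Matrix (Fin m) (Fin m) ℝ} (h : M * N = 1) (c : Fin m → ℝ) :
    Function.Injective fun (z : EuclideanSpace ℝ (Fin m)) i => linearForm (M i) z - c i := by
  intro z z' hz
  have hinj := Matrix.mulVec_injective_of_isUnit
    (IsUnit.of_mul_eq_one N h)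
  apply (WithLp.ofLp_injective 2)
  apply hinj
  ext i
  have := congrFun hz i
  simp only [linearForm_apply, sub_left_inj] at this
  exact this

/-- Jointly Gaussian vectors with an absolutely continuous joint law have canonical
coordinates. -/
theorem exists_isCanonicalPair (hgauss : HasGaussianLaw (fun ω => (X ω, Y ω)) P)
    (hac : P.map (fun ω => (X ω, Y ω)) ≪ volume) :
    ∃ (T₁ : EuclideanSpace ℝ (Fin m) → Fin m → ℝ) (T₂ : EuclideanSpace ℝ (Fin n) → Fin n → ℝ),
      MeasurableEmbedding T₁ ∧ MeasurableEmbedding T₂ ∧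
      IsCanonicalPair (fun i ω => T₁ (X ω) i) (fun j ω => T₂ (Y ω) j)
        (Matrix.toEuclideanLin (whitenedCrossCov X Y P)).singularValues P := by
  have hX := hgauss.fst
  have hY := hgauss.snd
  have : (volume : Measure (EuclideanSpace ℝ (Fin m) × EuclideanSpace ℝ (Fin n))).IsAddHaarMeasure :=
    Measure.prod.instIsAddHaarMeasure _ _
  have hvar : ∀ l : EuclideanSpace ℝ (Fin m) × EuclideanSpace ℝ (Fin n) →L[ℝ] ℝ, l ≠ 0 →
      0 < Var[fun ω => l (X ω, Y ω); P] := fun l hl =>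
    variance_pos_of_absolutelyContinuous hgauss.aemeasurable hac hl (hgauss.map_fun l).memLp_two
  have hA : (crossCov X X P).PosDef := posDef_crossCov hX fun p hp => by
    refine hvar ((linearForm p).comp (.fst ℝ _ _)) fun h => linearForm_ne_zero hp ?_
    ext z
    exact DFunLike.congr_fun h (z, 0)
  have hB : (crossCov Y Y P).PosDef := posDef_crossCov hY fun p hp => by
    refine hvar ((linearForm p).comp (.snd ℝ _ _)) fun h => linearForm_ne_zero hp ?_
    ext z
    exact DFunLike.congr_fun h (0, z)
  obtain ⟨M, N, hM, hN, hMN⟩ := exists_canonical_coordinates hA hB (crossCov X Y P)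
  let c : Fin m → ℝ := fun i => P[fun ω => linearForm (M i) (X ω)]
  let d : Fin n → ℝ := fun j => P[fun ω => linearForm (N j) (Y ω)]
  set σ := (Matrix.toEuclideanLin (whitenedCrossCov X Y P)).singularValues with hσ
  have iX := fun p => (memLp_linearForm hX p).integrable one_le_two
  have iY := fun p => (memLp_linearForm hY p).integrable one_le_two
  have hcross : ∀ i j, cov[fun ω => linearForm (M i) (X ω), fun ω => linearForm (N j) (Y ω); P] =
      if (i : ℕ) = j then σ j else 0 := fun i j => by
    rw [covariance_linearForm_eq_mul hX hY, hMN]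
    rfl
  have hleft : ∀ i i', cov[fun ω => linearForm (M i) (X ω), fun ω => linearForm (M i') (X ω); P] =
      if i = i' then 1 else 0 := fun i i' => by
    rw [covariance_linearForm_eq_mul hX hX, hM, Matrix.one_apply]
  have hright : ∀ j j', cov[fun ω => linearForm (N j) (Y ω), fun ω => linearForm (N j') (Y ω); P] =
      if j = j' then 1 else 0 := fun j j' => by
    rw [covariance_linearForm_eq_mul hY hY, hN, Matrix.one_apply]
  have hzero : ∀ j, min m n ≤ j → σ j = 0 := by
    intro j hj
    rw [hσ, LinearMap.singularValues_eq_zero_iff_le_finrank_range]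
    refine le_trans (le_min ?_ ?_) hj
    · exact (Submodule.finrank_le _).trans (by simp)
    · exact (LinearMap.finrank_range_le _).trans (by simp)
  -- For `j < min m n`, nondegeneracy of the joint law gives `0 < Var(x_j - y_j) = 2 - 2 σ j`. With
  -- `σ j ≥ 0` this yields `σ j ^ 2 < 1`.
  have hlt : ∀ j, 0 < 1 - σ j ^ 2 := by
    intro j
    by_cases hj : min m n ≤ j
    · simp [hzero j hj]
    have hjm : j < m := (not_le.1 hj).trans_le (min_le_left _ _)
    have hjn : j < n := (not_le.1 hj).trans_le (min_le_right _ _)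
    let l := (linearForm (M ⟨j, hjm⟩)).comp (.fst ℝ _ (EuclideanSpace ℝ (Fin n))) -
      (linearForm (N ⟨j, hjn⟩)).comp (.snd ℝ (EuclideanSpace ℝ (Fin m)) _)
    -- If `l` vanished, so would the form defining `x_j`, whose variance is `1`.
    have hl : l ≠ 0 := by
      intro h
      have h0 : ∀ z, linearForm (M ⟨j, hjm⟩) z = 0 := fun z => by
        simpa [l] using DFunLike.congr_fun h (z, 0)
      have h1 := hleft ⟨j, hjm⟩ ⟨j, hjm⟩
      simp only [h0, if_true] at h1
      rw [covariance_const_left] at h1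
      exact zero_ne_one h1
    have h := hvar l hl
    have e : (fun ω => l (X ω, Y ω)) = fun ω =>
      linearForm (M ⟨j, hjm⟩) (X ω) - linearForm (N ⟨j, hjn⟩) (Y ω) := rfl
    rw [← covariance_self (hgauss.map_fun l).aemeasurable, e,
      covariance_fun_sub_fun_sub (memLp_linearForm hX _) (memLp_linearForm hY _)
        (memLp_linearForm hX _) (memLp_linearForm hY _), hleft, hright, hcross,
      covariance_comm, hcross] at h
    simp only [if_true] at h
    have h0 : 0 ≤ σ j := LinearMap.singularValues_nonneg _ _
    nlinarith
  -- In the form `M * (A * Mᵀ) = 1`, the whitening identity displays a right inverse of `M`.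
  rw [Matrix.mul_assoc] at hM hN
  refine ⟨fun z i => linearForm (M i) z - c i, fun z j => linearForm (N j) z - d j,
    Continuous.measurableEmbedding (by fun_prop) (linearForm_injective hM c),
    Continuous.measurableEmbedding (by fun_prop) (linearForm_injective hN d), ?_, ?_, ?_, ?_, ?_, ?_, hlt, hzero⟩
  · let L : EuclideanSpace ℝ (Fin m) × EuclideanSpace ℝ (Fin n) →L[ℝ] (Fin m ⊕ Fin n → ℝ) :=
      ContinuousLinearMap.pi <| Sum.elim
        (fun i => (linearForm (M i)).comp (.fst ℝ _ _))
        (fun j => (linearForm (N j)).comp (.snd ℝ _ _))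
    have hL := hgauss.map_fun L
    have := hL.isGaussian_map
    have hsub : HasLaw (fun ω => L (X ω, Y ω) - Sum.elim c d)
        ((P.map fun ω => L (X ω, Y ω)).map fun z => z - Sum.elim c d) P :=
      ⟨hL.aemeasurable.sub_const _, by
        rw [AEMeasurable.map_map_of_aemeasurable (by fun_prop) hL.aemeasurable]; rfl⟩
    refine hsub.hasGaussianLaw.congr (.of_forall fun ω => funext fun s => ?_)
    rcases s with i | j <;> rfl
  · intro i
    rw [integral_sub (iX _) (integrable_const _)]
    simp [c]
  · intro j
    rw [integral_sub (iY _) (integrable_const _)]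
    simp [d]
  · intro i i'
    rw [covariance_sub_const_left (iX _), covariance_sub_const_right (iX _), hleft]
  · intro j j'
    rw [covariance_sub_const_left (iY _), covariance_sub_const_right (iY _), hright]
  · intro i j
    rw [covariance_sub_const_left (iX _), covariance_sub_const_right (iY _), hcross]

/-- The mutual information and the profile of a nondegenerate jointly Gaussian pair. -/
theorem mutualInfo_and_pmiProfile_eq (hgauss : HasGaussianLaw (fun ω => (X ω, Y ω)) P)
    (hnice : HasSmoothPosDensities X Y P) :
    (∀ i, 0 < 1 - canonicalCorrelation X Y P i ^ 2) ∧ mutualInfo X Y P ≠ ∞ ∧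
      (mutualInfo X Y P).toReal =
        -(1 / 2) * ∑ i, Real.log (1 - canonicalCorrelation X Y P i ^ 2) ∧
      pmiProfile X Y P =
        chiSquaredDiff (mutualInfo X Y P).toReal (canonicalCorrelation X Y P) := by
  have hX := hgauss.fst.aemeasurable
  have hY := hgauss.snd.aemeasurable
  obtain ⟨p, hp⟩ := hnice.joint
  have hac : P.map (fun ω => (X ω, Y ω)) ≪ volume := by
    rw [hp.eq_withDensity]
    exact withDensity_absolutelyContinuous _ _
  obtain ⟨T₁, T₂, h₁, h₂, hc⟩ := exists_isCanonicalPair hgauss hac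
  set σ := (Matrix.toEuclideanLin (whitenedCrossCov X Y P)).singularValues
  let g : (Fin m → ℝ) × (Fin n → ℝ) → ℝ := IsCanonicalPair.density σ
  have hg : Measurable g := IsCanonicalPair.measurable_density
  have hgpos : ∀ z, 0 < g z := fun z =>
    Finset.prod_pos fun j _ => correlationDensity_pos (hc.one_sub_sq_pos j) _ _
  let h : EuclideanSpace ℝ (Fin m) × EuclideanSpace ℝ (Fin n) → ℝ := g ∘ Prod.map T₁ T₂
  have hh : Measurable h := hg.comp (h₁.measurable.prodMap h₂.measurable)
  have := Measure.isProbabilityMeasure_map (μ := P) hX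
  have := Measure.isProbabilityMeasure_map (μ := P) hY
  have hd : P.map (fun ω => (X ω, Y ω)) =
      ((P.map X).prod (P.map Y)).withDensity fun z => ENNReal.ofReal (h z) := by
    refine eq_withDensity_comp_of_map h₁ h₂ (f := fun z => ENNReal.ofReal (g z)) ?_
    rw [AEMeasurable.map_map_of_aemeasurable
      (h₁.measurable.prodMap h₂.measurable).aemeasurable (hX.prodMk hY),
      AEMeasurable.map_map_of_aemeasurable h₁.measurable.aemeasurable hX,
      AEMeasurable.map_map_of_aemeasurable h₂.measurable.aemeasurable hY]
    exact hc.map_prod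
  have hlaw : HasLaw (fun ω => Real.log (h (X ω, Y ω))) _ P := hc.hasLaw_log_density
  have hint : Integrable (fun ω => Real.log (h (X ω, Y ω))) P := by
    have hi := integrable_pow_chiSquaredDiff
      (-(1 / 2) * ∑ i : Fin (min m n), Real.log (1 - σ i ^ 2)) (fun i : Fin (min m n) => σ i) 1
    simp only [pow_one] at hi
    rw [← hlaw.map_eq, integrable_map_measure (by fun_prop) hlaw.aemeasurable] at hi
    exact hi
  obtain ⟨hfin, hval⟩ := mutualInfo_eq_integral_log hX hY hh (fun z => hgpos _) hd hint
  -- The divergence is the mean of the log density, and that mean is the centre of symmetry of its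
  -- law.
  have hI : (mutualInfo X Y P).toReal =
      -(1 / 2) * ∑ i, Real.log (1 - canonicalCorrelation X Y P i ^ 2) := by
    rw [hval, hlaw.integral_eq, integral_chiSquaredDiff]
    rfl
  refine ⟨fun i => hc.one_sub_sq_pos i, hfin, hI, ?_⟩
  rw [pmiProfile, Measure.map_congr (pmi_ae_eq_log hnice hX hY hh (fun z => hgpos _) hd),
    hlaw.map_eq, hI]
  rfl

end

end PMI

end

theorem mainTheorem2 {Ω : Type*} [MeasurableSpace Ω] (P : Measure Ω)
    [IsProbabilityMeasure P] {m n : ℕ}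
    (X : Ω → EuclideanSpace ℝ (Fin m)) (Y : Ω → EuclideanSpace ℝ (Fin n))
    (hgauss : HasGaussianLaw (fun ω => (X ω, Y ω)) P)
    (hnice : PMI.HasSmoothPosDensities X Y P)
    (ρ : Fin (min m n) → ℝ) (hρ : ρ = PMI.canonicalCorrelation X Y P) :
    -- mutual information is finite, with the stated value (and the logarithms make sense)
    PMI.mutualInfo X Y P ≠ ∞ ∧
    (∀ i, 0 < 1 - ρ i ^ 2) ∧
    (PMI.mutualInfo X Y P).toReal = -(1 / 2) * ∑ i, Real.log (1 - ρ i ^ 2) ∧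
    -- the profile is the law of `I(X;Y) + ∑ (ρ_i / 2) (Q_i - Q'_i)`
    (∀ {Ω' : Type*} [MeasurableSpace Ω'] (P' : Measure Ω') [IsProbabilityMeasure P']
      (Q Q' : Fin (min m n) → Ω' → ℝ),
      (∀ i, HasLaw (Q i) PMI.chiSquaredOne P') →
      (∀ i, HasLaw (Q' i) PMI.chiSquaredOne P') →
      iIndepFun (Sum.elim Q Q') P' →
      HasLaw (fun ω => (PMI.mutualInfo X Y P).toReal + ∑ i, ρ i / 2 * (Q i ω - Q' i ω))
        (PMI.pmiProfile X Y P) P') ∧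
    -- symmetry around the median, which is unique and coincides with the mean `I(X;Y)`
    PMI.IsSymmetricAround (PMI.pmiProfile X Y P) (PMI.mutualInfo X Y P).toReal ∧
    (∀ c : ℝ, PMI.IsMedian (PMI.pmiProfile X Y P) c ↔ c = (PMI.mutualInfo X Y P).toReal) ∧
    Integrable (fun t : ℝ => t) (PMI.pmiProfile X Y P) ∧
    ∫ t, t ∂(PMI.pmiProfile X Y P) = (PMI.mutualInfo X Y P).toReal ∧
    -- all moments exist, and the variance
    (∀ r : ℕ, Integrable (fun t : ℝ => t ^ r) (PMI.pmiProfile X Y P)) ∧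
    variance (fun t : ℝ => t) (PMI.pmiProfile X Y P) = ∑ i, ρ i ^ 2 := by
  subst hρ
  obtain ⟨hpos, hfin, hI, hprof⟩ := PMI.mutualInfo_and_pmiProfile_eq hgauss hnice
  rw [hprof]
  have hsymm := PMI.isSymmetricAround_chiSquaredDiff (PMI.mutualInfo X Y P).toReal
    (PMI.canonicalCorrelation X Y P)
  refine ⟨hfin, hpos, hI, fun P' _ Q Q' hQ hQ' hind => PMI.hasLaw_chiSquaredDiff _ _ hQ hQ' hind,
    hsymm, hsymm.isMedian_iff fun ε hε => PMI.chiSquaredDiff_ball_pos _ _ hε, ?_,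
    PMI.integral_chiSquaredDiff _ _, PMI.integrable_pow_chiSquaredDiff _ _,
    PMI.variance_chiSquaredDiff _ _⟩
  simpa using PMI.integrable_pow_chiSquaredDiff _ _ 1
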